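/- Let $\{|k\rangle\}_{k\ge 0}$ be the Fock basis of the Hilbert space of one bosonic mode. On system mode $\otimes$ environment mode define operators by their matrix elements $\langle m_1,m_2|U|n_1,n_2\rangle$ in the two-mode Fock basis. Amplifier (two-mode squeezer), $\kappa\ge 1$: $U[\mathcal A(\kappa)]$ has elements $$\kappa^{-1}\sqrt{\tfrac{n_1!\,m_2!}{m_1!\,n_2!}}\sum_{r=0}^{n_2}\sum_{j=0}^{m_1}\binom{n_2}{r}\binom{m_1}{j}(-1)^r\kappa^{-(n_2+j-r)}\bigl(\sqrt{1-\kappa^{-2}}\bigr)^{m_1+r-j}\,\delta_{n_1,r+j}\,\delta_{m_2,n_2+m_1-r-j}.$$ Attenuator (beamsplitter), $0\le\kappa\le 1$: $U[\mathcal B(\kappa)]$ has elements $$\sqrt{\tfrac{m_1!\,m_2!}{n_1!\,n_2!}}\sum_{r=0}^{n_1}\sum_{j=0}^{n_2}\binom{n_1}{r}\binom{n_2}{j}(-1)^{n_2-j}\kappa^{n_1-r+j}\bigl(\sqrt{1-\kappa^2}\bigr)^{r+n_2-j}\,\delta_{m_2,r+j}\,\delta_{m_1,n_1+n_2-r-j}.$$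 Phase conjugator, $\kappa\ge 0$: $U[\mathcal C(\kappa)]$ has elements $$\tfrac{1}{\sqrt{1+\kappa^2}}\sqrt{\tfrac{n_2!\,m_2!}{m_1!\,n_1!}}\sum_{r=0}^{m_1}\sum_{j=0}^{n_1}\binom{m_1}{r}\binom{n_1}{j}\bigl(\sqrt{1+\kappa^2}\bigr)^{-(n_1+r-j)}(-1)^j\Bigl(\tfrac{\kappa}{\sqrt{1+\kappa^2}}\Bigr)^{m_1-r+j}\delta_{n_2,r+j}\,\delta_{m_2,n_1+m_1-r-j}.$$ (Here $0^0=1$.) For $\Phi\in\{\mathcal A,\mathcal B,\mathcal C\}$ and $n\ge 0$, the $n$-photon-added channel and its complementary channel map a density operator $\rho$ of one mode to $$\Phi(\kappa;n)[\rho]=\mathrm{Tr}_E\bigl[U[\Phi(\kappa)]\,(\rho\otimes|n\rangle\langle n|)\,U[\Phi(\kappa)]^\dagger\bigr],\qquad \Phi(\kappa;n)^c[\rho]=\mathrm{Tr}_A\bigl[U[\Phi(\kappa)]\,(\rho\otimes|n\rangle\langle n|)\,U[\Phi(\kappa)]^\dagger\bigr],$$ where $\mathrm{Tr}_E$ is the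 partial trace over the environment and $\mathrm{Tr}_A$ the partial trace over the system (after which the environment mode is identified with the system mode through the Fock basis). **Proposition.** (1) Let $\kappa\ge 1$. Then $U[\mathcal A(\kappa)]$ and $U[\mathcal C(\sqrt{\kappa^2-1})]$ are well-defined unitary operators, and for every $n\ge 0$ the complementary channel of the photon-added amplifier $\mathcal A(\kappa;n)$ is the photon-added phase conjugator $\mathcal C(\sqrt{\kappa^2-1};n)$: for every density operator $\rho$, $$\mathcal A(\kappa;n)^c[\rho]=\mathcal C(\sqrt{\kappa^2-1};n)[\rho],$$ and this is a density operator. Moreover $U[\mathcal C(\sqrt{\kappa^2-1})]=U[\mathcal A(\kappa)]\,U_{\mathrm{flip}}$, where $U_{\mathrm{flip}}|n_1,n_2\rangle=|n_2,n_1\rangle$. (2) Let $0\le\kappa\le 1$. Then $U[\mathcal B(\kappa)]$ is a well-defined unitary operator, and for every $n\ge 0$ the complementary channel of the photon-added attenuator $\mathcal B(\kappa;n)$ is the photon-added attenuator $\mathcal B(\sqrt{1-\kappa^2};n)$: for every density operator $\rho$, $$\mathcal B(\kappa;n)^c[\rho]=\mathcal B(\sqrt{1-\kappa^2};n)[\rho],$$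 and this is a density operator. Moreover $U[\mathcal B(\sqrt{1-\kappa^2})]=U_{\mathrm{flip}}\,U[\mathcal B(\kappa)]\,(1\otimes(-1)^{\hat n})$, where $(1\otimes(-1)^{\hat n})|n_1,n_2\rangle=(-1)^{n_2}|n_1,n_2\rangle$. -/

import Mathlib

open scoped ENNReal InnerProductSpace

noncomputable section

namespace PhotonAdded

/-- The Hilbert space of one bosonic mode: square-summable sequences indexed by photon number. -/
abbrev Mode : Type := lp (fun _ : ℕ => ℂ) 2

/-- The Hilbert space of the pair (system mode, environment mode), realised as `ℓ²(ℕ × ℕ)`. -/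
abbrev TwoMode : Type := lp (fun _ : ℕ × ℕ => ℂ) 2

/-- The Fock state `|k⟩`. -/
def fock (k : ℕ) : Mode := lp.single 2 k 1

/-- The two-mode Fock state `|p.1, p.2⟩`. -/
def fock₂ (p : ℕ × ℕ) : TwoMode := lp.single 2 p 1

theorem summable_sq (f : Mode) : Summable (fun i => ‖f i‖ ^ (2 : ℝ)) := by
  simpa using (lp.memℓp f).summable (by simp)

theorem summable_tensor (f g : Mode) :
    Summable (fun p : ℕ × ℕ => ‖f p.1 * g p.2‖ ^ (2 : ℝ)) := by
  have h := (summable_sq f).mul_of_nonneg (summable_sq g)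
    (fun i => by positivity) (fun i => by positivity)
  refine h.congr fun p => ?_
  rw [norm_mul, Real.mul_rpow (norm_nonneg _) (norm_nonneg _)]

/-- The product vector `f ⊗ g`, with coordinates `f i * g j`. -/
def tensor (f g : Mode) : TwoMode :=
  ⟨fun p => f p.1 * g p.2, memℓp_gen (by simpa using summable_tensor f g)⟩

theorem norm_tensor (f g : Mode) : ‖tensor f g‖ = ‖f‖ * ‖g‖ := by
  have h2 : (0 : ℝ) < (2 : ℝ≥0∞).toReal := by simp
  have hf := lp.norm_rpow_eq_tsum h2 f
  have hg := lp.norm_rpow_eq_tsum h2 g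
  have ht := lp.norm_rpow_eq_tsum h2 (tensor f g)
  simp only [ENNReal.toReal_ofNat] at hf hg ht
  have hm : ‖tensor f g‖ ^ (2 : ℝ) = (‖f‖ * ‖g‖) ^ (2 : ℝ) := by
    rw [Real.mul_rpow (norm_nonneg _) (norm_nonneg _), hf, hg, ht,
      tsum_mul_tsum_of_summable_norm (summable_sq f).norm (summable_sq g).norm]
    refine tsum_congr fun p => ?_
    rw [← Real.mul_rpow (norm_nonneg _) (norm_nonneg _), ← norm_mul]
    rfl
  exact (Real.rpow_left_inj (norm_nonneg _) (by positivity) two_ne_zero).1 hm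

/-- The operator `f ↦ f ⊗ ψ` that appends the environment vector `ψ`. -/
def appendEnv (ψ : Mode) : Mode →L[ℂ] TwoMode :=
  LinearMap.mkContinuous
    { toFun := fun f => tensor f ψ
      map_add' := fun f g => by
        ext p
        change (f p.1 + g p.1) * ψ p.2 = f p.1 * ψ p.2 + g p.1 * ψ p.2
        ring
      map_smul' := fun c f => by
        ext p
        change (c * f p.1) * ψ p.2 = c * (f p.1 * ψ p.2)
        ring }
    ‖ψ‖ (fun f => by
      change ‖tensor f ψ‖ ≤ ‖ψ‖ * ‖f‖
      rw [norm_tensor, mul_comm])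

/-- The operator `f ↦ χ ⊗ f` that places `f` in the environment mode next to the system vector
`χ`. -/
def appendSys (χ : Mode) : Mode →L[ℂ] TwoMode :=
  LinearMap.mkContinuous
    { toFun := fun f => tensor χ f
      map_add' := fun f g => by
        ext p
        change χ p.1 * (f p.2 + g p.2) = χ p.1 * f p.2 + χ p.1 * g p.2
        ring
      map_smul' := fun c f => by
        ext p
        change χ p.1 * (c * f p.2) = c * (χ p.1 * f p.2)
        ring }
    ‖χ‖ (fun f => by
      change ‖tensor χ f‖ ≤ ‖χ‖ * ‖f‖
      rw [norm_tensor])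

/-- Quantum states of one mode: positive operators of trace one. -/
def IsState (ρ : Mode →L[ℂ] Mode) : Prop :=
  ρ.IsPositive ∧ HasSum (fun k : ℕ => ⟪fock k, ρ (fock k)⟫_ℂ) 1

/-- The operator `ρ ⊗ |ψ⟩⟨ψ|`. -/
def withEnv (ρ : Mode →L[ℂ] Mode) (ψ : Mode) : TwoMode →L[ℂ] TwoMode :=
  (appendEnv ψ).comp (ρ.comp (ContinuousLinearMap.adjoint (appendEnv ψ)))

/-- The partial trace `Tr_E X = ∑ₖ ⟨k|_E X |k⟩_E` over the environment, a series in operator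
norm (it converges in operator norm for every trace class operator `X`). -/
def traceEnv (X : TwoMode →L[ℂ] TwoMode) : Mode →L[ℂ] Mode :=
  ∑' k : ℕ, (ContinuousLinearMap.adjoint (appendEnv (fock k))).comp (X.comp (appendEnv (fock k)))

/-- The partial trace `Tr_A X = ∑ₖ ⟨k|_A X |k⟩_A` over the system. -/
def traceSys (X : TwoMode →L[ℂ] TwoMode) : Mode →L[ℂ] Mode :=
  ∑' k : ℕ, (ContinuousLinearMap.adjoint (appendSys (fock k))).comp (X.comp (appendSys (fock k)))

/-- The data of a Stinespring representation with a pure environment state: the operator coupling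
system and environment, and the environment vector. -/
structure Dilation where
  coupling : TwoMode →L[ℂ] TwoMode
  env : Mode

/-- The joint output `U (ρ ⊗ |ψ⟩⟨ψ|) U†`. -/
def Dilation.output (D : Dilation) (ρ : Mode →L[ℂ] Mode) : TwoMode →L[ℂ] TwoMode :=
  D.coupling.comp ((withEnv ρ D.env).comp (ContinuousLinearMap.adjoint D.coupling))

/-- The channel `ρ ↦ Tr_E [U (ρ ⊗ |ψ⟩⟨ψ|) U†]`. -/
def Dilation.channel (D : Dilation) (ρ : Mode →L[ℂ] Mode) : Mode →L[ℂ] Mode :=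
  traceEnv (D.output ρ)

/-- The complementary channel `ρ ↦ Tr_A [U (ρ ⊗ |ψ⟩⟨ψ|) U†]`. -/
def Dilation.complementaryChannel (D : Dilation) (ρ : Mode →L[ℂ] Mode) : Mode →L[ℂ] Mode :=
  traceSys (D.output ρ)

/-- A coefficient array: `T m n` stands for `⟨m₁, m₂| U |n₁, n₂⟩`. -/
abbrev FockArray : Type := ℕ × ℕ → ℕ × ℕ → ℝ

/-- `U` has the matrix elements `⟨m₁, m₂| U |n₁, n₂⟩ = T m n`. -/
def HasFockElements (U : TwoMode →L[ℂ] TwoMode) (T : FockArray) : Prop :=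
  ∀ m n : ℕ × ℕ, ⟪fock₂ m, U (fock₂ n)⟫_ℂ = (T m n : ℂ)

open Classical in
/-- The bounded operator with the given Fock matrix elements (there is at most one); the value is
`0` if no bounded operator has these matrix elements. -/
def fockOperator (T : FockArray) : TwoMode →L[ℂ] TwoMode :=
  if h : ∃ U : TwoMode →L[ℂ] TwoMode, HasFockElements U T then h.choose else 0

/-- Fock matrix elements of the two-mode squeezing unitary (amplifier), `κ ≥ 1`. The condition in
the `if` is the product of the two Kronecker deltas. -/
def ampElements (κ : ℝ) : FockArray := fun m n =>
  κ⁻¹ * √(((n.1.factorial * m.2.factorial : ℕ) : ℝ) / ((m.1.factorial * n.2.factorial : ℕ) : ℝ)) *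
    ∑ r ∈ Finset.range (n.2 + 1), ∑ j ∈ Finset.range (m.1 + 1),
      if n.1 = r + j ∧ m.2 + r + j = n.2 + m.1 then
        (n.2.choose r : ℝ) * (m.1.choose j : ℝ) * (-1) ^ r *
          (κ⁻¹) ^ (n.2 + j - r) * (√(1 - (κ⁻¹) ^ 2)) ^ (m.1 + r - j)
      else 0

/-- Fock matrix elements of the beamsplitter unitary (attenuator), `0 ≤ κ ≤ 1`. -/
def attElements (κ : ℝ) : FockArray := fun m n =>
  √(((m.1.factorial * m.2.factorial : ℕ) : ℝ) / ((n.1.factorial * n.2.factorial : ℕ) : ℝ)) *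
    ∑ r ∈ Finset.range (n.1 + 1), ∑ j ∈ Finset.range (n.2 + 1),
      if m.2 = r + j ∧ m.1 + r + j = n.1 + n.2 then
        (n.1.choose r : ℝ) * (n.2.choose j : ℝ) * (-1) ^ (n.2 - j) *
          κ ^ (n.1 - r + j) * (√(1 - κ ^ 2)) ^ (r + n.2 - j)
      else 0

/-- Fock matrix elements of the phase-conjugation unitary, `κ ≥ 0`. The factor
`(√(1 + κ⁻²))⁻¹` is written as `κ / √(1 + κ²)`: this is the same number for `κ > 0`, and its
limit `0` at `κ = 0`. -/
def conjElements (κ : ℝ) : FockArray := fun m n =>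
  (√(1 + κ ^ 2))⁻¹ *
    √(((n.2.factorial * m.2.factorial : ℕ) : ℝ) / ((m.1.factorial * n.1.factorial : ℕ) : ℝ)) *
    ∑ r ∈ Finset.range (m.1 + 1), ∑ j ∈ Finset.range (n.1 + 1),
      if n.2 = r + j ∧ m.2 + r + j = n.1 + m.1 then
        (m.1.choose r : ℝ) * (n.1.choose j : ℝ) * ((√(1 + κ ^ 2))⁻¹) ^ (n.1 + r - j) *
          (-1) ^ j * (κ / √(1 + κ ^ 2)) ^ (m.1 - r + j)
      else 0

/-- The unitary of the amplifier. -/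
def ampU (κ : ℝ) : TwoMode →L[ℂ] TwoMode := fockOperator (ampElements κ)

/-- The unitary of the attenuator. -/
def attU (κ : ℝ) : TwoMode →L[ℂ] TwoMode := fockOperator (attElements κ)

/-- The unitary of the phase conjugator. -/
def conjU (κ : ℝ) : TwoMode →L[ℂ] TwoMode := fockOperator (conjElements κ)

/-- The mode flip `|n₁, n₂⟩ ↦ |n₂, n₁⟩`. -/
def flipU : TwoMode →L[ℂ] TwoMode :=
  fockOperator fun m n => if m.1 = n.2 ∧ m.2 = n.1 then 1 else 0

/-- The local phase operator `|n₁, n₂⟩ ↦ (-1)^{n₂} |n₁, n₂⟩` on the second mode. -/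
def phaseU : TwoMode →L[ℂ] TwoMode :=
  fockOperator fun m n => if m.1 = n.1 ∧ m.2 = n.2 then (-1) ^ n.2 else 0

/-- The photon-added amplifier: environment prepared in the Fock state `|n⟩`. -/
def amplifier (κ : ℝ) (n : ℕ) : Dilation := ⟨ampU κ, fock n⟩

/-- The photon-added attenuator. -/
def attenuator (κ : ℝ) (n : ℕ) : Dilation := ⟨attU κ, fock n⟩

/-- The photon-added phase conjugator. -/
def phaseConjugator (κ : ℝ) (n : ℕ) : Dilation := ⟨conjU κ, fock n⟩

/-- `U` is a unitary operator with the given Fock matrix elements. -/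
def IsUnitaryWithElements (U : TwoMode →L[ℂ] TwoMode) (T : FockArray) : Prop :=
  U ∈ unitary (TwoMode →L[ℂ] TwoMode) ∧ HasFockElements U T

end PhotonAdded

end

/-! Up to square roots of factorials, every matrix element is a coefficient of `(c - s X) ^ p * (s +
c X) ^ q` with `c ^ 2 + s ^ 2 = 1`; see `ampElements_eq`, `attElements_eq` and `conjElements_eq`.
These coefficients satisfy a Krawtchouk duality, `binomCoeff_dual`, which makes each array symmetric
up to signs under transposition. Orthonormality of the rows therefore follows from that of the
columns, and the two together give unitarity.

For the beamsplitter the column sums are finite, and orthonormality says that a linear substitution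
composed with itself, up to signs, is the identity (`hasSum_splitArray`). For the squeezer they are
infinite series. A contraction identity and Euler's identity relate neighbouring Gram entries up to
a telescoping term, and the induction ends at a negative binomial series (`hasSum_squeezeTerm_step`,
`hasSum_squeezeTerm`).

Tracing out the system is tracing out the environment after a flip, so the complement of the channel
of `U` is the channel of `flipU.comp U`. Duality and the reversal `X ↦ 1 / X` show that the squeezer
commutes with the flip, which makes this coupling the phase conjugator. For the beamsplitter, the
flip gives the beamsplitter with `c` and `s` interchanged, up to the parity of the environment. That
parity is a scalar on a Fock state and cancels.

The outputs are states because, with `ρ = S * S` and `V` the isometry that appends the environment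
and applies the coupling, the joint output is `A† A` for the Hilbert–Schmidt operator `A = S V†`,
whose squared norm is the trace of `ρ`. -/

noncomputable section

namespace PhotonAdded

/-! ### Coefficients of products of powers of two linear polynomials -/

open Polynomial in
/-- The coefficient of `X ^ k` in `(a + b X) ^ p * (a' + b' X) ^ q`. -/
def binomCoeff (a b a' b' : ℝ) (p q k : ℕ) : ℝ :=
  ((C a + C b * X) ^ p * (C a' + C b' * X) ^ q).coeff k

section BinomCoeff

variable (a b a' b' : ℝ) (p q k : ℕ)

theorem binomCoeff_succ_left_zero :
    binomCoeff a b a' b' (p + 1) q 0 = a * binomCoeff a b a' b' p q 0 := by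
  simp [binomCoeff, pow_succ', Polynomial.mul_coeff_zero, mul_assoc]

theorem binomCoeff_succ_left_succ :
    binomCoeff a b a' b' (p + 1) q (k + 1) =
      a * binomCoeff a b a' b' p q (k + 1) + b * binomCoeff a b a' b' p q k := by
  simp only [binomCoeff, pow_succ', mul_assoc, add_mul, Polynomial.coeff_add,
    Polynomial.coeff_C_mul, Polynomial.coeff_X_mul]

theorem binomCoeff_comm : binomCoeff a b a' b' p q k = binomCoeff a' b' a b q p k := by
  simp only [binomCoeff, mul_comm]

theorem binomCoeff_succ_right_zero :
    binomCoeff a b a' b' p (q + 1) 0 = a' * binomCoeff a b a' b' p q 0 := by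
  rw [binomCoeff_comm, binomCoeff_succ_left_zero, binomCoeff_comm]

theorem binomCoeff_succ_right_succ :
    binomCoeff a b a' b' p (q + 1) (k + 1) =
      a' * binomCoeff a b a' b' p q (k + 1) + b' * binomCoeff a b a' b' p q k := by
  rw [binomCoeff_comm, binomCoeff_succ_left_succ, binomCoeff_comm a b, binomCoeff_comm a b]

theorem binomCoeff_zero_left (h : k ≤ q) :
    binomCoeff a b a' b' 0 q k = q.choose k * a' ^ (q - k) * b' ^ k := by
  induction q generalizing k with
  | zero =>
    obtain rfl : k = 0 := by omega
    simp [binomCoeff]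
  | succ q ih =>
    cases k with
    | zero => rw [binomCoeff_succ_right_zero, ih 0 (by omega)]; simp [pow_succ']
    | succ k =>
      rw [binomCoeff_succ_right_succ, ih k (by omega), Nat.choose_succ_succ]
      rcases Nat.lt_or_ge k q with hk | hk
      · rw [ih (k + 1) hk, show q + 1 - (k + 1) = q - (k + 1) + 1 by omega,
          show q - k = q - (k + 1) + 1 by omega]
        push_cast
        ring
      · obtain rfl : k = q := by omega
        have : binomCoeff a b a' b' 0 k (k + 1) = 0 := by
          rw [binomCoeff, pow_zero, one_mul]
          refine Polynomial.coeff_eq_zero_of_natDegree_lt (Nat.lt_succ_of_le ?_)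
          refine Polynomial.natDegree_pow_le_of_le k (m := 1) ?_ |>.trans (by simp)
          compute_degree
        rw [this]
        simp [pow_succ']

theorem binomCoeff_eq_zero (h : p + q < k) : binomCoeff a b a' b' p q k = 0 := by
  refine Polynomial.coeff_eq_zero_of_natDegree_lt (lt_of_le_of_lt ?_ h)
  refine Polynomial.natDegree_mul_le_of_le ?_ ?_
  · refine Polynomial.natDegree_pow_le_of_le p (m := 1) ?_ |>.trans (by simp)
    compute_degree
  · refine Polynomial.natDegree_pow_le_of_le q (m := 1) ?_ |>.trans (by simp)
    compute_degree

theorem binomCoeff_eq_sum :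
    binomCoeff a b a' b' p q k =
      ∑ r ∈ Finset.range (p + 1), ∑ j ∈ Finset.range (q + 1),
        if k = r + j then (p.choose r * a ^ (p - r) * b ^ r) * (q.choose j * a' ^ (q - j) * b' ^ j)
        else 0 := by
  have key : ∀ (u v : ℝ) (N : ℕ), (Polynomial.C u + Polynomial.C v * Polynomial.X) ^ N =
      ∑ r ∈ Finset.range (N + 1), Polynomial.monomial r (N.choose r * u ^ (N - r) * v ^ r) := by
    intro u v N
    rw [add_comm, add_pow]
    refine Finset.sum_congr rfl fun r _ => ?_
    rw [← Polynomial.C_mul_X_pow_eq_monomial]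
    simp only [mul_pow, map_mul, map_pow, map_natCast]
    ring
  rw [binomCoeff, key, key, Finset.sum_mul_sum, Polynomial.finsetSum_coeff]
  refine Finset.sum_congr rfl fun r _ => ?_
  rw [Polynomial.finsetSum_coeff]
  refine Finset.sum_congr rfl fun j _ => ?_
  rw [Polynomial.monomial_mul_monomial, Polynomial.coeff_monomial]
  simp only [eq_comm]

/-- Euler's identity for a homogeneous product. -/
theorem binomCoeff_euler :
    ((p : ℝ) + q - k) * binomCoeff a b a' b' p q k =
      p * a * binomCoeff a b a' b' (p - 1) q k + q * a' * binomCoeff a b a' b' p (q - 1) k := by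
  have key : ∀ (u v : ℝ) (N : ℕ), Polynomial.derivative
      ((Polynomial.C u + Polynomial.C v * Polynomial.X) ^ N) * Polynomial.X =
      (N : Polynomial ℝ) * (Polynomial.C u + Polynomial.C v * Polynomial.X) ^ N -
        (N : Polynomial ℝ) * Polynomial.C u * (Polynomial.C u + Polynomial.C v * Polynomial.X) ^ (N - 1) := by
    intro u v N
    cases N with
    | zero => simp
    | succ N =>
      rw [Polynomial.derivative_pow]
      simp
      ring
  have h : Polynomial.derivative
        ((Polynomial.C a + Polynomial.C b * Polynomial.X) ^ p *
          (Polynomial.C a' + Polynomial.C b' * Polynomial.X) ^ q) * Polynomial.X =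
      Polynomial.C ((p : ℝ) + q) * ((Polynomial.C a + Polynomial.C b * Polynomial.X) ^ p *
          (Polynomial.C a' + Polynomial.C b' * Polynomial.X) ^ q) -
        Polynomial.C (p * a) * ((Polynomial.C a + Polynomial.C b * Polynomial.X) ^ (p - 1) *
          (Polynomial.C a' + Polynomial.C b' * Polynomial.X) ^ q) -
        Polynomial.C (q * a') * ((Polynomial.C a + Polynomial.C b * Polynomial.X) ^ p *
          (Polynomial.C a' + Polynomial.C b' * Polynomial.X) ^ (q - 1)) := by
    rw [Polynomial.derivative_mul]
    have h1 := key a b p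
    have h2 := key a' b' q
    simp only [map_add, map_mul, map_natCast]
    linear_combination (Polynomial.C a' + Polynomial.C b' * Polynomial.X) ^ q * h1 +
      (Polynomial.C a + Polynomial.C b * Polynomial.X) ^ p * h2
  have h' := congrArg (fun P : Polynomial ℝ => P.coeff k) h
  simp only [Polynomial.coeff_sub, Polynomial.coeff_C_mul] at h'
  change _ = _ * binomCoeff a b a' b' p q k - _ * binomCoeff a b a' b' (p - 1) q k -
    _ * binomCoeff a b a' b' p (q - 1) k at h'
  have h3 : (Polynomial.derivative
        ((Polynomial.C a + Polynomial.C b * Polynomial.X) ^ p *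
          (Polynomial.C a' + Polynomial.C b' * Polynomial.X) ^ q) * Polynomial.X).coeff k =
      k * binomCoeff a b a' b' p q k := by
    cases k with
    | zero => simp
    | succ k =>
      rw [Polynomial.coeff_mul_X, Polynomial.coeff_derivative, binomCoeff]
      push_cast
      ring
  rw [h3] at h'
  linear_combination -h'

/-- The substitution `X ↦ 1 / X` reverses a polynomial of formal degree `p + q` and exchanges the
two coefficients of each linear factor. -/
theorem binomCoeff_reverse (l : ℕ) (h : k + l = p + q) :
    binomCoeff a b a' b' p q k = binomCoeff b a b' a' p q l := by
  rw [binomCoeff_eq_sum, binomCoeff_eq_sum, ← Finset.sum_range_reflect]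
  refine Finset.sum_congr rfl fun r hr => ?_
  rw [← Finset.sum_range_reflect]
  refine Finset.sum_congr rfl fun j hj => ?_
  have hr := Finset.mem_range.1 hr
  have hj := Finset.mem_range.1 hj
  rw [show p + 1 - 1 - r = p - r by omega, show q + 1 - 1 - j = q - j by omega,
    Nat.choose_symm (by omega), Nat.choose_symm (by omega), show p - (p - r) = r by omega,
    show q - (q - j) = j by omega]
  refine if_congr (by omega) (by ring) rfl

theorem binomCoeff_neg_left :
    binomCoeff (-a) (-b) a' b' p q k = (-1) ^ p * binomCoeff a b a' b' p q k := by
  rw [binomCoeff, show (Polynomial.C (-a) + Polynomial.C (-b) * Polynomial.X) =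
    Polynomial.C (-1 : ℝ) * (Polynomial.C a + Polynomial.C b * Polynomial.X) by simp; ring,
    mul_pow, ← Polynomial.C_pow, mul_assoc, Polynomial.coeff_C_mul, binomCoeff]

theorem binomCoeff_neg_right :
    binomCoeff a b (-a') (-b') p q k = (-1) ^ q * binomCoeff a b a' b' p q k := by
  rw [binomCoeff_comm, binomCoeff_neg_left, binomCoeff_comm]

theorem binomCoeff_neg_X :
    binomCoeff a (-b) a' (-b') p q k = (-1) ^ k * binomCoeff a b a' b' p q k := by
  rw [binomCoeff_eq_sum, binomCoeff_eq_sum, Finset.mul_sum]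
  refine Finset.sum_congr rfl fun r _ => ?_
  rw [Finset.mul_sum]
  refine Finset.sum_congr rfl fun j _ => ?_
  split_ifs with h
  · rw [h, neg_pow b, neg_pow b', pow_add]
    ring
  · simp

/-- Once all coefficients are replaced by absolute values, a single term is at most the whole
polynomial evaluated at `ε`. A small `ε` turns this into geometric decay in `q`. -/
theorem abs_binomCoeff_mul_pow_le {ε : ℝ} (hε : 0 ≤ ε) :
    |binomCoeff a b a' b' p q k| * ε ^ k ≤ (|a| + |b| * ε) ^ p * (|a'| + |b'| * ε) ^ q := by
  induction p generalizing k with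
  | zero =>
    induction q generalizing k with
    | zero =>
      cases k with
      | zero => simp [binomCoeff]
      | succ k => rw [binomCoeff_eq_zero _ _ _ _ _ _ _ (by omega)]; simp
    | succ q ih =>
      cases k with
      | zero =>
        rw [binomCoeff_succ_right_zero, abs_mul, pow_succ]
        have := ih 0
        have h1 : |a'| ≤ |a'| + |b'| * ε := le_add_of_nonneg_right (by positivity)
        calc _ = (|binomCoeff a b a' b' 0 q 0| * ε ^ 0) * |a'| := by ring
          _ ≤ _ := by rw [← mul_assoc]; gcongr
      | succ k =>
        rw [binomCoeff_succ_right_succ]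
        have h0 := ih k
        have h1 := ih (k + 1)
        calc _ ≤ (|a' * binomCoeff a b a' b' 0 q (k + 1)| + |b' * binomCoeff a b a' b' 0 q k|) *
              ε ^ (k + 1) := by gcongr; exact abs_add_le _ _
          _ = |a'| * (|binomCoeff a b a' b' 0 q (k + 1)| * ε ^ (k + 1)) +
              |b'| * ε * (|binomCoeff a b a' b' 0 q k| * ε ^ k) := by
            rw [abs_mul, abs_mul]; ring
          _ ≤ |a'| * ((|a| + |b| * ε) ^ 0 * (|a'| + |b'| * ε) ^ q) +
              |b'| * ε * ((|a| + |b| * ε) ^ 0 * (|a'| + |b'| * ε) ^ q) := by gcongr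
          _ = _ := by ring
  | succ p ih =>
    cases k with
    | zero =>
      rw [binomCoeff_succ_left_zero, abs_mul, pow_succ]
      have := ih 0
      have h1 : |a| ≤ |a| + |b| * ε := le_add_of_nonneg_right (by positivity)
      calc _ = |a| * (|binomCoeff a b a' b' p q 0| * ε ^ 0) := by ring
        _ ≤ (|a| + |b| * ε) * ((|a| + |b| * ε) ^ p * (|a'| + |b'| * ε) ^ q) := by gcongr
        _ = _ := by ring
    | succ k =>
      rw [binomCoeff_succ_left_succ]
      have h0 := ih k
      have h1 := ih (k + 1)
      calc _ ≤ (|a * binomCoeff a b a' b' p q (k + 1)| + |b * binomCoeff a b a' b' p q k|) *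
            ε ^ (k + 1) := by gcongr; exact abs_add_le _ _
        _ = |a| * (|binomCoeff a b a' b' p q (k + 1)| * ε ^ (k + 1)) +
            |b| * ε * (|binomCoeff a b a' b' p q k| * ε ^ k) := by
          rw [abs_mul, abs_mul]; ring
        _ ≤ |a| * ((|a| + |b| * ε) ^ p * (|a'| + |b'| * ε) ^ q) +
            |b| * ε * ((|a| + |b| * ε) ^ p * (|a'| + |b'| * ε) ^ q) := by gcongr
        _ = _ := by ring

/-- This is the homogeneous form of the generating function. With `U` and `V` themselves linear
polynomials it computes compositions of linear substitutions. -/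
theorem sum_antidiagonal_binomCoeff {R : Type*} [CommRing R] [Algebra ℝ R] (U V : R) (N : ℕ)
    (h : p + q = N) :
    ∑ x ∈ Finset.HasAntidiagonal.antidiagonal N, algebraMap ℝ R (binomCoeff a b a' b' p q x.2) * U ^ x.1 * V ^ x.2 =
      (algebraMap ℝ R a * U + algebraMap ℝ R b * V) ^ p *
        (algebraMap ℝ R a' * U + algebraMap ℝ R b' * V) ^ q := by
  have key : ∀ (N : ℕ) (u v : ℝ) (F G : ℕ → ℝ), G 0 = u * F 0 →
      (∀ k, G (k + 1) = u * F (k + 1) + v * F k) → F (N + 1) = 0 →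
      ∑ x ∈ Finset.HasAntidiagonal.antidiagonal (N + 1), algebraMap ℝ R (G x.2) * U ^ x.1 * V ^ x.2 =
        (algebraMap ℝ R u * U + algebraMap ℝ R v * V) *
          ∑ x ∈ Finset.HasAntidiagonal.antidiagonal N, algebraMap ℝ R (F x.2) * U ^ x.1 * V ^ x.2 := by
    intro N u v F G h0 h1 h2
    have e1 : ∑ x ∈ Finset.HasAntidiagonal.antidiagonal (N + 1), algebraMap ℝ R (G x.2) * U ^ x.1 * V ^ x.2 =
        algebraMap ℝ R u *
          ∑ x ∈ Finset.HasAntidiagonal.antidiagonal (N + 1), algebraMap ℝ R (F x.2) * U ^ x.1 * V ^ x.2 +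
        algebraMap ℝ R v * V *
          ∑ x ∈ Finset.HasAntidiagonal.antidiagonal N, algebraMap ℝ R (F x.2) * U ^ x.1 * V ^ x.2 := by
      rw [Finset.Nat.sum_antidiagonal_succ', Finset.Nat.sum_antidiagonal_succ', h0, mul_add,
        Finset.mul_sum, Finset.mul_sum, add_assoc, ← Finset.sum_add_distrib]
      congr 1
      · rw [map_mul]; ring
      · refine Finset.sum_congr rfl fun x _ => ?_
        rw [h1, map_add, map_mul, map_mul]
        ring
    rw [e1, Finset.Nat.sum_antidiagonal_succ, h2, add_mul, Finset.mul_sum, Finset.mul_sum]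
    congr 1
    rw [map_zero, zero_mul, zero_mul, zero_add, Finset.mul_sum]
    refine Finset.sum_congr rfl fun x _ => ?_
    ring
  induction p generalizing N with
  | zero =>
    induction q generalizing N with
    | zero => subst h; simp [binomCoeff]
    | succ q ih =>
      subst h
      rw [← add_assoc, key (0 + q) a' b' (binomCoeff a b a' b' 0 q) _
        (binomCoeff_succ_right_zero _ _ _ _ _ _) (binomCoeff_succ_right_succ _ _ _ _ _ _)
        (binomCoeff_eq_zero _ _ _ _ _ _ _ (by omega)), ih _ rfl]
      ring
  | succ p ih =>
    subst h
    rw [show p + 1 + q = p + q + 1 by ring, key (p + q) a b (binomCoeff a b a' b' p q) _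
      (binomCoeff_succ_left_zero _ _ _ _ _ _) (binomCoeff_succ_left_succ _ _ _ _ _ _)
      (binomCoeff_eq_zero _ _ _ _ _ _ _ (by omega)), ih _ rfl]
    ring

end BinomCoeff

/-! ### Duality and contraction for the rotation coefficients -/

/-- Self-duality of the coefficients of `(c - s X) ^ p * (s + c X) ^ q` (Krawtchouk
polynomials). -/
theorem binomCoeff_dual (c s : ℝ) (p q k l : ℕ) (h : k + l = p + q) :
    (k.factorial * l.factorial : ℝ) * (-1) ^ k * binomCoeff c (-s) s c p q k =
      (p.factorial * q.factorial : ℝ) * (-1) ^ q * binomCoeff c (-s) s c l k q := by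
  induction p generalizing k l with
  | zero =>
    -- For `p = 0` the left coefficient is a binomial term and the right one is a leading
    -- coefficient, read off as a constant term after reversal.
    obtain rfl : q = k + l := by omega
    rw [binomCoeff_zero_left _ _ _ _ _ _ (by omega),
      binomCoeff_reverse _ _ _ _ l k (k + l) 0 (by omega), binomCoeff_eq_sum]
    have : ((k + l).choose k * k.factorial * l.factorial : ℝ) = (k + l).factorial := by
      rw [Nat.choose_symm_add]
      exact_mod_cast Nat.add_choose_mul_factorial_mul_factorial k l
    rw [Finset.sum_eq_single 0, Finset.sum_eq_single 0]
    · simp only [Nat.add_sub_cancel_left, Nat.factorial_zero, Nat.cast_one, Nat.sub_zero,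
        if_pos, Nat.choose_zero_right, pow_zero]
      rw [← this, neg_pow s, pow_add]
      have h2 : ((-1 : ℝ) ^ l) * (-1) ^ l = 1 := by rw [← mul_pow]; simp
      linear_combination (-((k + l).choose k * k.factorial * l.factorial : ℝ) * (-1) ^ k *
        s ^ l * c ^ k) * h2
    · intro j _ hj
      rw [if_neg (by omega)]
    · simp
    · intro r _ hr
      refine Finset.sum_eq_zero fun j _ => ?_
      rw [if_neg (by omega)]
    · simp
  | succ p ih =>
    -- Euler's identity on the dual side carries the factor `l + k - q = p + 1`, the new factor of
    -- `(p + 1)!`. Its two terms match the two terms of the recursion in `p`.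
    have e := binomCoeff_euler c (-s) s c l k q
    have hN : (l : ℝ) + k - q = p + 1 := by
      have : (k : ℝ) + l = p + 1 + q := by exact_mod_cast h
      linarith
    rw [hN] at e
    rw [Nat.factorial_succ, Nat.cast_mul, Nat.cast_succ]
    have e2 : (p.factorial * q.factorial : ℝ) * (-1) ^ q *
          (l * c * binomCoeff c (-s) s c (l - 1) k q + k * s * binomCoeff c (-s) s c l (k - 1) q) =
        (k.factorial * l.factorial : ℝ) * (-1) ^ k * binomCoeff c (-s) s c (p + 1) q k := by
      have t1 : (p.factorial * q.factorial : ℝ) * (-1) ^ q *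
          (l * c * binomCoeff c (-s) s c (l - 1) k q) =
          (k.factorial * l.factorial : ℝ) * (-1) ^ k * (c * binomCoeff c (-s) s c p q k) := by
        cases l with
        -- With `l = 0` the index `k = p + 1 + q` exceeds the degree `p + q`.
        | zero => rw [binomCoeff_eq_zero _ _ _ _ _ _ k (by omega)]; simp
        | succ l =>
          have := ih k l (by omega)
          rw [Nat.factorial_succ]
          rw [Nat.add_sub_cancel]
          push_cast
          linear_combination -(l + 1 : ℝ) * c * this
      cases k with
      | zero =>
        rw [binomCoeff_succ_left_zero, ← t1]
        simp
      | succ k =>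
        have := ih k l (by omega)
        rw [binomCoeff_succ_left_succ, mul_add, mul_add, t1, Nat.add_sub_cancel, Nat.factorial_succ]
        push_cast
        linear_combination -(k + 1 : ℝ) * s * this
    linear_combination -e2 - (p.factorial * q.factorial : ℝ) * (-1) ^ q * e

/-- This is the relation `c (c - s X) + s (s + c X) = 1`. -/
theorem binomCoeff_contract (c s : ℝ) (h : c ^ 2 + s ^ 2 = 1) (p q k : ℕ) :
    c * binomCoeff c (-s) s c (p + 1) q k + s * binomCoeff c (-s) s c p (q + 1) k =
      binomCoeff c (-s) s c p q k := by
  cases k with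
  | zero =>
    rw [binomCoeff_succ_left_zero, binomCoeff_succ_right_zero]
    linear_combination binomCoeff c (-s) s c p q 0 * h
  | succ k =>
    rw [binomCoeff_succ_left_succ, binomCoeff_succ_right_succ]
    linear_combination binomCoeff c (-s) s c p q (k + 1) * h

/-! ### Gram series of the squeezing array -/

theorem hasSum_of_eq {ι α : Type*} [AddCommMonoid α] [TopologicalSpace α] {f g : ι → α} {x y : α}
    (hf : HasSum f x) (hfg : ∀ i, g i = f i) (hxy : y = x) : HasSum g y := by
  rw [hxy, show g = f from funext hfg]
  exact hf

/-- The summand of the Gram matrix of the squeezing array, within one sector of fixed photon number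
difference. -/
def squeezeTerm (c s : ℝ) (p k p' k' q : ℕ) : ℝ :=
  ((q + p - k).factorial : ℝ) / q.factorial *
    (binomCoeff c (-s) s c p q k * binomCoeff c (-s) s c p' q k')

theorem squeezeTerm_comm (c s : ℝ) {p k p' k' : ℕ} (h : p + k' = p' + k) (q : ℕ) :
    squeezeTerm c s p k p' k' q = squeezeTerm c s p' k' p k q := by
  rw [squeezeTerm, squeezeTerm, show q + p - k = q + p' - k' by omega,
    mul_comm (binomCoeff _ _ _ _ _ _ _)]

theorem exists_abs_binomCoeff_le {c s : ℝ} (hc : 0 < c) (h : c ^ 2 + s ^ 2 = 1) (p k : ℕ) :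
    ∃ M : ℝ, 0 ≤ M ∧ ∀ q, |binomCoeff c (-s) s c p q k| ≤ M * ((1 + |s|) / 2) ^ q := by
  have hs : |s| < 1 := by rw [abs_lt]; constructor <;> nlinarith
  have hc1 : c ≤ 1 := by nlinarith
  -- Since `c ≤ 1`, the choice `ε = (1 - |s|) / 2` gives `|s| + c * ε ≤ (1 + |s|) / 2 < 1`.
  have hε : 0 < (1 - |s|) / 2 := by linarith
  refine ⟨(|c| + |-s| * ((1 - |s|) / 2)) ^ p / ((1 - |s|) / 2) ^ k, by positivity, fun q => ?_⟩
  have := abs_binomCoeff_mul_pow_le c (-s) s c p q k hε.le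
  rw [div_mul_eq_mul_div, le_div_iff₀ (by positivity)]
  refine this.trans ?_
  gcongr
  rw [abs_of_pos hc]
  nlinarith

/-- Contraction lowers `p + 1` in the first coefficient, and Euler's identity lowers `p'` or `q` in
the second. The terms with factor `s` are consecutive values of one sequence `g` and telescope. -/
theorem hasSum_squeezeTerm_step {c s : ℝ} (hc : 0 < c) (h : c ^ 2 + s ^ 2 = 1) {p k p' k' : ℕ}
    (hk : p + 1 + k' = p' + k) {S : ℝ}
    (hS : HasSum (fun q => (p' : ℝ) * squeezeTerm c s p k (p' - 1) k' q) S) :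
    HasSum (squeezeTerm c s (p + 1) k p' k') S := by
  set g : ℕ → ℝ := fun q => q * (((q + p - k).factorial : ℝ) / q.factorial *
    (binomCoeff c (-s) s c p q k * binomCoeff c (-s) s c p' (q - 1) k')) with hg
  have g_succ : ∀ q, g (q + 1) = ((q + 1 + p - k).factorial : ℝ) / q.factorial *
      (binomCoeff c (-s) s c p (q + 1) k * binomCoeff c (-s) s c p' q k') := by
    intro q
    have : (q.factorial : ℝ) ≠ 0 := by positivity
    simp only [hg, Nat.add_sub_cancel, Nat.factorial_succ]
    push_cast
    field_simp
  -- The factorial ratio grows polynomially in `q`, while each coefficient decays like `ρ ^ q`.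
  have hsum : Summable g := by
    obtain ⟨M, hM, h1⟩ := exists_abs_binomCoeff_le hc h p k
    obtain ⟨M', hM', h2⟩ := exists_abs_binomCoeff_le hc h p' k'
    have hs : |s| < 1 := by rw [abs_lt]; constructor <;> nlinarith
    have h0 := abs_nonneg s
    set ρ := (1 + |s|) / 2 with hρ
    have hρ0 : 0 ≤ ρ := by positivity
    have hρ1 : ρ < 1 := by rw [hρ]; linarith
    rw [← summable_nat_add_iff 1]
    have hgeo : Summable fun q : ℕ => ((q + (p + 1)).choose (p + 1) : ℝ) * (ρ ^ 2) ^ q :=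
      summable_choose_mul_geometric_of_norm_lt_one (p + 1)
        (by rw [Real.norm_of_nonneg (by positivity)]; nlinarith)
    refine Summable.of_norm_bounded (hgeo.mul_left ((p + 1).factorial * (M * M'))) fun q => ?_
    rw [g_succ, Real.norm_eq_abs, abs_mul, abs_mul, abs_of_nonneg (by positivity)]
    have hf : ((q + 1 + p - k).factorial : ℝ) / q.factorial ≤
        (p + 1).factorial * (q + (p + 1)).choose (p + 1) := by
      rw [div_le_iff₀ (by positivity)]
      have e := Nat.add_choose_mul_factorial_mul_factorial q (p + 1)
      have e' : (q + 1 + p - k).factorial ≤ (q + (p + 1)).factorial :=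
        Nat.factorial_le (by omega)
      rw [← e] at e'
      refine (Nat.cast_le.2 e').trans_eq ?_
      push_cast
      ring
    calc _ ≤ ((p + 1).factorial * (q + (p + 1)).choose (p + 1) : ℝ) *
          ((M * ρ ^ (q + 1)) * (M' * ρ ^ q)) := by
          gcongr
          · exact h1 _
          · exact h2 _
      _ ≤ ((p + 1).factorial * (q + (p + 1)).choose (p + 1) : ℝ) *
          ((M * ρ ^ q) * (M' * ρ ^ q)) := by
          gcongr ?_ * (M * ?_ * ?_)
          exact pow_le_pow_of_le_one hρ0 hρ1.le (by omega)
      _ = _ := by rw [← pow_mul, mul_comm 2, pow_mul]; ring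
  -- The total is `g 0`, which vanishes through the factor `q` in `g`.
  have htel : HasSum (fun q => g q - g (q + 1)) 0 := by
    have h1 := hsum.hasSum
    have h2 := (hasSum_nat_add_iff' 1).2 h1
    have h3 := h1.sub h2
    simpa [hg] using h3
  have hpt : ∀ q, c * squeezeTerm c s (p + 1) k p' k' q =
      c * (p' * squeezeTerm c s p k (p' - 1) k' q) + s * (g q - g (q + 1)) := by
    intro q
    have hcon := binomCoeff_contract c s h p q k
    have heul := binomCoeff_euler c (-s) s c p' q k'
    rw [g_succ]
    simp only [hg, squeezeTerm]
    rw [show q + (p + 1) - k = q + 1 + p - k by omega]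
    -- For `q + p < k` the subtraction `q + p - k` truncates, but the coefficient of index `k` is
    -- zero there.
    rcases Nat.lt_or_ge (q + p) k with hlt | hge
    · rw [binomCoeff_eq_zero _ _ _ _ p q k (by omega)] at hcon ⊢
      linear_combination ((q + 1 + p - k).factorial : ℝ) / q.factorial *
        binomCoeff c (-s) s c p' q k' * hcon
    · have hN : (p' : ℝ) + q - k' = (q + p - k : ℕ) + 1 := by
        rw [Nat.cast_sub hge]
        have : (p : ℝ) + 1 + k' = p' + k := by exact_mod_cast hk
        push_cast
        linarith
      rw [hN] at heul
      rw [show q + 1 + p - k = q + p - k + 1 by omega, Nat.factorial_succ]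
      push_cast
      linear_combination ((q + p - k : ℕ) + 1 : ℝ) * ((q + p - k).factorial : ℝ) / q.factorial *
        binomCoeff c (-s) s c p' q k' * hcon +
        ((q + p - k).factorial : ℝ) / q.factorial * binomCoeff c (-s) s c p q k * heul
  have hfin := ((hS.mul_left c).add (htel.mul_left s)).mul_left c⁻¹
  refine hasSum_of_eq hfin (fun q => ?_) ?_
  · rw [← hpt, inv_mul_cancel_left₀ hc.ne']
  · rw [mul_zero, add_zero, inv_mul_cancel_left₀ hc.ne']

/-- The series is a multiple of the negative binomial series in `s ^ 2`, with `1 - s ^ 2 = c ^ 2`.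
-/
theorem hasSum_squeezeTerm_zero {c s : ℝ} (hc : 0 < c) (h : c ^ 2 + s ^ 2 = 1) (k : ℕ) :
    HasSum (squeezeTerm c s 0 k 0 k) (1 / (k.factorial * c ^ 2)) := by
  have hlt : ∀ q, q < k → squeezeTerm c s 0 k 0 k q = 0 := by
    intro q hq
    rw [squeezeTerm, binomCoeff_eq_zero _ _ _ _ 0 q k (by omega)]
    simp
  have hadd : ∀ i, squeezeTerm c s 0 k 0 k (i + k) =
      c ^ (2 * k) / k.factorial * ((i + k).choose k * (s ^ 2) ^ i) := by
    intro i
    have e : ((i + k).choose k * i.factorial * k.factorial : ℝ) = (i + k).factorial := by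
      exact_mod_cast Nat.add_choose_mul_factorial_mul_factorial i k
    have : ((i + k).choose k : ℝ) ≠ 0 := by
      exact_mod_cast (Nat.choose_pos (Nat.le_add_left k i)).ne'
    rw [squeezeTerm, binomCoeff_zero_left _ _ _ _ _ _ (by omega), ← e, add_zero,
      Nat.add_sub_cancel]
    field_simp
    ring
  have hs : s ^ 2 < 1 := by nlinarith
  have hgeo := (hasSum_choose_mul_geometric_of_norm_lt_one k
    (show ‖s ^ 2‖ < 1 by rwa [Real.norm_of_nonneg (by positivity)])).mul_left
      (c ^ (2 * k) / k.factorial)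
  have := (hasSum_nat_add_iff (f := squeezeTerm c s 0 k 0 k) k).1 (by simpa only [hadd] using hgeo)
  rw [Finset.sum_eq_zero fun i hi => hlt i (Finset.mem_range.1 hi), add_zero,
    show 1 - s ^ 2 = c ^ 2 by linarith] at this
  refine hasSum_of_eq this (fun _ => rfl) ?_
  field_simp
  ring

theorem hasSum_squeezeTerm {c s : ℝ} (hc : 0 < c) (h : c ^ 2 + s ^ 2 = 1) {p k p' k' : ℕ}
    (hk : p + k' = p' + k) :
    HasSum (squeezeTerm c s p k p' k')
      (if p = p' then (p.factorial : ℝ) / (k.factorial * c ^ 2) else 0) := by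
  induction p generalizing k p' k' with
  | zero =>
    cases p' with
    | zero =>
      obtain rfl : k' = k := by omega
      simpa using hasSum_squeezeTerm_zero hc h k'
    | succ p' =>
      -- By symmetry the zero index moves to the second place, where the step lemma multiplies by
      -- zero.
      have : squeezeTerm c s 0 k (p' + 1) k' = squeezeTerm c s (p' + 1) k' 0 k :=
        funext fun q => squeezeTerm_comm c s hk q
      rw [this, if_neg (by omega)]
      exact hasSum_squeezeTerm_step hc h (by omega) (by simp)
  | succ p ih =>
    refine hasSum_squeezeTerm_step hc h (by omega) ?_
    cases p' with
    | zero => simp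
    | succ p' =>
      have := (ih (k := k) (p' := p') (k' := k') (by omega)).mul_left ((p' + 1 : ℕ) : ℝ)
      refine hasSum_of_eq this (fun _ => rfl) ?_
      by_cases hp : p = p'
      · subst hp
        rw [if_pos rfl, if_pos rfl, Nat.factorial_succ]
        push_cast
        ring
      · rw [if_neg (by omega), if_neg hp, mul_zero]

/-! ### Orthonormal columns and symmetries of the two arrays -/

/-- The matrix elements of two-mode squeezing with parameters `c = 1 / cosh` and `s = tanh`. -/
def squeezeArray (c s : ℝ) : FockArray := fun m n =>
  c * √(((n.1.factorial * m.2.factorial : ℕ) : ℝ) / ((m.1.factorial * n.2.factorial : ℕ) : ℝ)) *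
    if m.1 + n.2 = m.2 + n.1 then binomCoeff c (-s) s c n.2 m.1 n.1 else 0

/-- The matrix elements of the beamsplitter with parameters `c` and `s`. -/
def splitArray (c s : ℝ) : FockArray := fun m n =>
  √(((m.1.factorial * m.2.factorial : ℕ) : ℝ) / ((n.1.factorial * n.2.factorial : ℕ) : ℝ)) *
    if m.1 + m.2 = n.1 + n.2 then binomCoeff c (-s) s c n.1 n.2 m.2 else 0

theorem hasSum_squeezeArray {c s : ℝ} (hc : 0 < c) (h : c ^ 2 + s ^ 2 = 1) (n n' : ℕ × ℕ) :
    HasSum (fun m => squeezeArray c s m n * squeezeArray c s m n') (if n = n' then 1 else 0) := by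
  by_cases hk : n.2 + n'.1 = n'.2 + n.1
  -- The two columns share a photon number difference, so their product is supported on one line,
  -- parametrised by `q = m.1`. Points with truncated subtraction contribute zero.
  · set e : ℕ → ℕ × ℕ := fun q => (q, q + n.2 - n.1) with he
    have hinj : Function.Injective e := fun q q' hq => congrArg Prod.fst hq
    rw [← hinj.hasSum_iff]
    · have := (hasSum_squeezeTerm hc h hk).mul_left
        (c ^ 2 * √((n.1.factorial : ℝ) / n.2.factorial) * √((n'.1.factorial : ℝ) / n'.2.factorial))
      refine hasSum_of_eq this (fun q => ?_) ?_
      · have hsplit : ∀ a : ℕ × ℕ, √(((a.1.factorial * (q + n.2 - n.1).factorial : ℕ) : ℝ) /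
            ((q.factorial * a.2.factorial : ℕ) : ℝ)) =
            √((a.1.factorial : ℝ) / a.2.factorial) *
              √(((q + n.2 - n.1).factorial : ℝ) / q.factorial) := by
          intro a
          rw [← Real.sqrt_mul (by positivity)]
          congr 1
          push_cast
          rw [div_mul_div_comm, mul_comm (q.factorial : ℝ)]
        have hsq : √(((q + n.2 - n.1).factorial : ℝ) / q.factorial) *
            √(((q + n.2 - n.1).factorial : ℝ) / q.factorial) =
            ((q + n.2 - n.1).factorial : ℝ) / q.factorial := Real.mul_self_sqrt (by positivity)
        simp only [Function.comp_apply, squeezeArray, he, hsplit, squeezeTerm]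
        rcases Nat.lt_or_ge (q + n.2) n.1 with hlt | hge
        · rw [if_neg (by omega), binomCoeff_eq_zero _ _ _ _ n.2 q n.1 (by omega)]
          simp
        · rw [if_pos (by omega), if_pos (by omega)]
          linear_combination c ^ 2 * √((n.1.factorial : ℝ) / n.2.factorial) *
            √((n'.1.factorial : ℝ) / n'.2.factorial) * (binomCoeff c (-s) s c n.2 q n.1 *
            binomCoeff c (-s) s c n'.2 q n'.1) * hsq
      · by_cases hn : n = n'
        · subst hn
          have hsq : √((n.1.factorial : ℝ) / n.2.factorial) * √((n.1.factorial : ℝ) / n.2.factorial)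
            = (n.1.factorial : ℝ) / n.2.factorial := Real.mul_self_sqrt (by positivity)
          rw [if_pos rfl, if_pos rfl, mul_assoc (c ^ 2), hsq]
          field_simp
        · rw [if_neg hn, if_neg, mul_zero]
          intro h2
          exact hn (Prod.ext (by omega) h2)
    · intro m hm
      rw [squeezeArray, if_neg, mul_zero, zero_mul]
      intro hm'
      exact hm ⟨m.1, Prod.ext rfl (by simp only [he]; omega)⟩
  · rw [if_neg (by rintro rfl; exact hk rfl)]
    refine hasSum_of_eq hasSum_zero (fun m => ?_) rfl
    by_cases h1 : m.1 + n.2 = m.2 + n.1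
    · rw [squeezeArray, squeezeArray, if_neg (c := m.1 + n'.2 = m.2 + n'.1) (by omega)]
      simp
    · rw [squeezeArray, if_neg h1]
      simp

/-- It transfers the factorial weights of the duality to the square-root normalisation of the
arrays. -/
theorem sqrt_div_mul_eq {u v x y : ℝ} (hu : 0 < u) (hv : 0 < v) (h : u * x = v * y) :
    √(u / v) * x = √(v / u) * y := by
  have e : ∀ {u v : ℝ}, 0 < u → 0 < v → √(u / v) = u / √(u * v) := by
    intro u v hu hv
    rw [eq_div_iff (by positivity), ← Real.sqrt_mul (by positivity),
      show u / v * (u * v) = u ^ 2 by field_simp, Real.sqrt_sq hu.le]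
  rw [e hu hv, e hv hu, mul_comm v u, div_mul_eq_mul_div, h, div_mul_eq_mul_div]

theorem squeezeArray_transpose (c s : ℝ) (m n : ℕ × ℕ) :
    squeezeArray c s n m = (-1) ^ (m.1 + n.1) * squeezeArray c s m n := by
  rw [squeezeArray, squeezeArray]
  by_cases h : m.1 + n.2 = m.2 + n.1
  · rw [if_pos h, if_pos (by omega)]
    have hd := binomCoeff_dual c s n.2 m.1 n.1 m.2 (by omega)
    have hsq : ∀ t : ℕ, ((-1 : ℝ) ^ t) * (-1) ^ t = 1 := fun t => by rw [← mul_pow]; simp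
    have := sqrt_div_mul_eq (u := ((n.1.factorial * m.2.factorial : ℕ) : ℝ))
      (v := ((m.1.factorial * n.2.factorial : ℕ) : ℝ))
      (x := (-1) ^ (m.1 + n.1) * binomCoeff c (-s) s c n.2 m.1 n.1)
      (y := binomCoeff c (-s) s c m.2 n.1 m.1) (by positivity) (by positivity) (by
        push_cast
        rw [pow_add]
        linear_combination (-1) ^ m.1 * hd +
          n.2.factorial * m.1.factorial * binomCoeff c (-s) s c m.2 n.1 m.1 * hsq m.1)
    linear_combination -c * this
  · rw [if_neg h, if_neg (by omega)]
    simp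

/-- The squeezer commutes with the mode flip: duality followed by reversal exchanges the modes, and
the signs cancel because the photon number difference is conserved. -/
theorem squeezeArray_swap (c s : ℝ) (m n : ℕ × ℕ) :
    squeezeArray c s m.swap n.swap = squeezeArray c s m n := by
  rw [squeezeArray, squeezeArray]
  by_cases h : m.1 + n.2 = m.2 + n.1
  · simp only [Prod.fst_swap, Prod.snd_swap]
    rw [if_pos h, if_pos (by omega)]
    have hd := binomCoeff_dual c s n.2 m.1 n.1 m.2 (by omega)
    have hr := binomCoeff_reverse c (-s) s c m.2 n.1 m.1 n.2 (by omega)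
    have hn : binomCoeff (-s) c c s m.2 n.1 n.2 =
        (-1) ^ n.2 * ((-1) ^ m.2 * binomCoeff c (-s) s c n.1 m.2 n.2) := by
      rw [← binomCoeff_neg_right, ← binomCoeff_neg_X, binomCoeff_comm]
      simp
    rw [hr, hn] at hd
    have hsq : ∀ t : ℕ, ((-1 : ℝ) ^ t) * (-1) ^ t = 1 := fun t => by rw [← mul_pow]; simp
    have hpar : (-1 : ℝ) ^ m.1 * (-1) ^ n.2 = (-1) ^ m.2 * (-1) ^ n.1 := by
      rw [← pow_add, ← pow_add, h]
    have := sqrt_div_mul_eq (u := ((n.1.factorial * m.2.factorial : ℕ) : ℝ))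
      (v := ((n.2.factorial * m.1.factorial : ℕ) : ℝ))
      (x := binomCoeff c (-s) s c n.2 m.1 n.1)
      (y := binomCoeff c (-s) s c n.1 m.2 n.2) (by positivity) (by positivity) (by
        push_cast
        linear_combination (-1) ^ n.1 * hd - n.1.factorial * m.2.factorial *
          binomCoeff c (-s) s c n.2 m.1 n.1 * hsq n.1 + n.2.factorial * m.1.factorial *
          binomCoeff c (-s) s c n.1 m.2 n.2 * ((-1) ^ n.1 * (-1) ^ m.2 * hpar +
          (-1) ^ m.2 * (-1) ^ m.2 * hsq n.1 + hsq m.2))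
    rw [mul_comm (m.1.factorial), mul_comm (m.2.factorial), mul_assoc, mul_assoc, this]
  · simp only [Prod.fst_swap, Prod.snd_swap]
    rw [if_neg h, if_neg (by omega)]
    simp

theorem splitArray_transpose (c s : ℝ) (m n : ℕ × ℕ) :
    splitArray c s n m = (-1) ^ (m.2 + n.2) * splitArray c s m n := by
  rw [splitArray, splitArray]
  by_cases h : m.1 + m.2 = n.1 + n.2
  · rw [if_pos h, if_pos h.symm]
    have hd := binomCoeff_dual c s n.1 n.2 m.2 m.1 (by omega)
    have hsq : ∀ t : ℕ, ((-1 : ℝ) ^ t) * (-1) ^ t = 1 := fun t => by rw [← mul_pow]; simp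
    have := sqrt_div_mul_eq (u := ((m.1.factorial * m.2.factorial : ℕ) : ℝ))
      (v := ((n.1.factorial * n.2.factorial : ℕ) : ℝ))
      (x := (-1) ^ (m.2 + n.2) * binomCoeff c (-s) s c n.1 n.2 m.2)
      (y := binomCoeff c (-s) s c m.1 m.2 n.2) (by positivity) (by positivity) (by
        push_cast
        rw [pow_add]
        linear_combination (-1) ^ n.2 * hd +
          n.1.factorial * n.2.factorial * binomCoeff c (-s) s c m.1 m.2 n.2 * hsq n.2)
    linear_combination -this
  · rw [if_neg h, if_neg (Ne.symm h)]
    simp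

/-- Reversal exchanges the output modes; the second linear factor then changes sign, which produces
the parity of `n.2`. -/
theorem splitArray_swap (c s : ℝ) (m n : ℕ × ℕ) :
    splitArray (-s) (-c) m n = (-1) ^ n.2 * splitArray c s m.swap n := by
  rw [splitArray, splitArray]
  simp only [Prod.fst_swap, Prod.snd_swap]
  by_cases h : m.1 + m.2 = n.1 + n.2
  · rw [if_pos h, if_pos (by omega), binomCoeff_reverse _ _ _ _ n.1 n.2 m.2 m.1 (by omega), neg_neg,
      binomCoeff_neg_right, mul_comm m.2.factorial]
    ring
  · rw [if_neg h, if_neg (by omega)]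
    simp

theorem hasSum_splitArray {c s : ℝ} (h : c ^ 2 + s ^ 2 = 1) (n n' : ℕ × ℕ) :
    HasSum (fun m => splitArray c s m n * splitArray c s m n') (if n = n' then 1 else 0) := by
  by_cases hN : n.1 + n.2 = n'.1 + n'.2
  · have hfin : HasSum (fun m => splitArray c s m n * splitArray c s m n')
        (∑ m ∈ Finset.HasAntidiagonal.antidiagonal (n.1 + n.2),
          splitArray c s m n * splitArray c s m n') := by
      refine hasSum_sum_of_ne_finset_zero fun m hm => ?_
      rw [Finset.HasAntidiagonal.mem_antidiagonal] at hm
      rw [splitArray, if_neg hm]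
      simp
    refine hasSum_of_eq hfin (fun _ => rfl) ?_
    -- Duality turns the second array entry into a coefficient of `(c - s X) ^ m.1 * (-(s + c X)) ^
    -- m.2`. The sum over `m` is then a substitution, which collapses to `(-X) ^ n.2`.
    have hcomp := sum_antidiagonal_binomCoeff c (-s) s c n.1 n.2
      (Polynomial.C c + Polynomial.C (-s) * Polynomial.X)
      (-(Polynomial.C s + Polynomial.C c * Polynomial.X)) (n.1 + n.2) rfl
    have hone : (Polynomial.C c * Polynomial.C c + Polynomial.C s * Polynomial.C s :
        Polynomial ℝ) = 1 := by
      rw [← Polynomial.C_mul, ← Polynomial.C_mul, ← Polynomial.C_add, ← sq, ← sq, h,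
        Polynomial.C_1]
    have hrhs : (algebraMap ℝ (Polynomial ℝ) c * (Polynomial.C c + Polynomial.C (-s) * Polynomial.X)
        + algebraMap ℝ (Polynomial ℝ) (-s) * (-(Polynomial.C s + Polynomial.C c * Polynomial.X))) = 1
        := by
      simp only [Polynomial.algebraMap_eq, Polynomial.C_neg]
      linear_combination hone
    have hrhs' : (algebraMap ℝ (Polynomial ℝ) s * (Polynomial.C c + Polynomial.C (-s) * Polynomial.X)
        + algebraMap ℝ (Polynomial ℝ) c * (-(Polynomial.C s + Polynomial.C c * Polynomial.X))) =
        -Polynomial.X := by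
      simp only [Polynomial.algebraMap_eq, Polynomial.C_neg]
      linear_combination -Polynomial.X * hone
    rw [hrhs, hrhs', one_pow, one_mul] at hcomp
    have hco := congrArg (fun P : Polynomial ℝ => P.coeff n'.2) hcomp
    simp only [Polynomial.finsetSum_coeff, Polynomial.algebraMap_eq, mul_assoc,
      Polynomial.coeff_C_mul] at hco
    have hterm : ∀ m ∈ Finset.HasAntidiagonal.antidiagonal (n.1 + n.2),
        splitArray c s m n * splitArray c s m n' =
        (√((n.1.factorial * n.2.factorial : ℕ) : ℝ))⁻¹ * √((n'.1.factorial * n'.2.factorial : ℕ) : ℝ)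
          * (-1) ^ n'.2 * (binomCoeff c (-s) s c n.1 n.2 m.2 *
          ((Polynomial.C c + Polynomial.C (-s) * Polynomial.X) ^ m.1 *
            (-(Polynomial.C s + Polynomial.C c * Polynomial.X)) ^ m.2).coeff n'.2) := by
      intro m hm
      rw [Finset.HasAntidiagonal.mem_antidiagonal] at hm
      have hcoe : ((Polynomial.C c + Polynomial.C (-s) * Polynomial.X) ^ m.1 *
            (-(Polynomial.C s + Polynomial.C c * Polynomial.X)) ^ m.2).coeff n'.2 =
          (-1) ^ m.2 * binomCoeff c (-s) s c m.1 m.2 n'.2 := by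
        rw [← binomCoeff_neg_right, binomCoeff]
        simp only [Polynomial.C_neg]
        ring_nf
      have hd := binomCoeff_dual c s n'.1 n'.2 m.2 m.1 (by omega)
      have hsq : ∀ t : ℕ, ((-1 : ℝ) ^ t) * (-1) ^ t = 1 := fun t => by rw [← mul_pow]; simp
      have hM : √((m.1.factorial * m.2.factorial : ℕ) : ℝ) *
        √((m.1.factorial * m.2.factorial : ℕ) : ℝ) = ((m.1.factorial * m.2.factorial : ℕ) : ℝ) :=
        Real.mul_self_sqrt (by positivity)
      have hM' : √((n'.1.factorial * n'.2.factorial : ℕ) : ℝ) *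
        √((n'.1.factorial * n'.2.factorial : ℕ) : ℝ) =
        ((n'.1.factorial * n'.2.factorial : ℕ) : ℝ) := Real.mul_self_sqrt (by positivity)
      have hpos : √((n'.1.factorial * n'.2.factorial : ℕ) : ℝ) ≠ 0 := by positivity
      have hd' : ((m.1.factorial * m.2.factorial : ℕ) : ℝ) * binomCoeff c (-s) s c n'.1 n'.2 m.2 =
          ((n'.1.factorial * n'.2.factorial : ℕ) : ℝ) * ((-1) ^ n'.2 * ((-1) ^ m.2 *
            binomCoeff c (-s) s c m.1 m.2 n'.2)) := by
        push_cast
        linear_combination (-1) ^ m.2 * hd -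
          m.1.factorial * m.2.factorial * binomCoeff c (-s) s c n'.1 n'.2 m.2 * hsq m.2
      rw [hcoe, splitArray, splitArray, if_pos hm, if_pos (hm.trans hN),
        Real.sqrt_div (by positivity), Real.sqrt_div (by positivity)]
      rw [← hM, ← hM'] at hd'
      field_simp
      linear_combination binomCoeff c (-s) s c n.1 n.2 m.2 * hd'
    rw [Finset.sum_congr rfl hterm, ← Finset.mul_sum, hco]
    rw [neg_pow (Polynomial.X : Polynomial ℝ),
      show (-1 : Polynomial ℝ) ^ n.2 = Polynomial.C ((-1) ^ n.2) by simp,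
      Polynomial.coeff_C_mul, Polynomial.coeff_X_pow]
    by_cases hn : n = n'
    · subst hn
      have : ((-1 : ℝ) ^ n.2) * (-1) ^ n.2 = 1 := by rw [← mul_pow]; simp
      have hpos : √((n.1.factorial * n.2.factorial : ℕ) : ℝ) ≠ 0 := by positivity
      rw [if_pos rfl, if_pos rfl, inv_mul_cancel₀ hpos, mul_one, one_mul, this]
    · rw [if_neg hn, if_neg (fun h2 => hn (Prod.ext (by omega) h2.symm))]
      simp
  · rw [if_neg (by rintro rfl; exact hN rfl)]
    refine hasSum_of_eq hasSum_zero (fun m => ?_) rfl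
    by_cases h1 : m.1 + m.2 = n.1 + n.2
    · rw [splitArray, splitArray, if_neg (c := m.1 + m.2 = n'.1 + n'.2) (by omega)]
      simp
    · rw [splitArray, if_neg h1]
      simp

/-! ### The given matrix elements as these arrays -/

theorem ampElements_eq (κ : ℝ) : ampElements κ = squeezeArray κ⁻¹ √(1 - κ⁻¹ ^ 2) := by
  funext m n
  rw [ampElements, squeezeArray, binomCoeff_eq_sum]
  congr 1
  split_ifs with h
  · refine Finset.sum_congr rfl fun r hr => Finset.sum_congr rfl fun j hj => ?_
    have hr := Finset.mem_range.1 hr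
    have hj := Finset.mem_range.1 hj
    refine if_congr (by omega) ?_ rfl
    rw [show n.2 + j - r = (n.2 - r) + j by omega, show m.1 + r - j = r + (m.1 - j) by omega,
      neg_pow √_, pow_add, pow_add]
    ring
  · refine Finset.sum_eq_zero fun r _ => Finset.sum_eq_zero fun j _ => if_neg (by omega)

theorem attElements_eq (κ : ℝ) : attElements κ = splitArray κ (-√(1 - κ ^ 2)) := by
  funext m n
  rw [attElements, splitArray, binomCoeff_eq_sum]
  congr 1
  split_ifs with h
  · refine Finset.sum_congr rfl fun r hr => Finset.sum_congr rfl fun j hj => ?_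
    have hr := Finset.mem_range.1 hr
    have hj := Finset.mem_range.1 hj
    refine if_congr (by omega) ?_ rfl
    rw [show r + n.2 - j = r + (n.2 - j) by omega, neg_neg, neg_pow √_, pow_add, pow_add]
    ring
  · refine Finset.sum_eq_zero fun r _ => Finset.sum_eq_zero fun j _ => if_neg (by omega)

theorem conjElements_eq {κ : ℝ} (hκ : 1 ≤ κ) (m n : ℕ × ℕ) :
    conjElements √(κ ^ 2 - 1) m n = ampElements κ m n.swap := by
  have h1 : √(1 + √(κ ^ 2 - 1) ^ 2) = κ := by
    rw [Real.sq_sqrt (by nlinarith), add_sub_cancel, Real.sqrt_sq (by linarith)]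
  have h2 : √(κ ^ 2 - 1) / κ = √(1 - κ⁻¹ ^ 2) := by
    rw [show 1 - κ⁻¹ ^ 2 = (κ ^ 2 - 1) / κ ^ 2 by field_simp,
      Real.sqrt_div (by nlinarith), Real.sqrt_sq (by linarith)]
  rw [conjElements, ampElements, h1, h2]
  simp only [Prod.fst_swap, Prod.snd_swap]
  congr 1
  rw [Finset.sum_comm]
  refine Finset.sum_congr rfl fun r hr => Finset.sum_congr rfl fun j hj => ?_
  have hr := Finset.mem_range.1 hr
  have hj := Finset.mem_range.1 hj
  refine if_congr (by omega) ?_ rfl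
  rw [show m.1 - j + r = m.1 + r - j by omega]
  ring

/-! ### From arrays to unitary operators -/

theorem inner_fock (k : ℕ) (x : Mode) : ⟪fock k, x⟫_ℂ = x k := by
  rw [fock, lp.inner_single_left]
  simp

theorem inner_fock₂ (p : ℕ × ℕ) (x : TwoMode) : ⟪fock₂ p, x⟫_ℂ = x p := by
  rw [fock₂, lp.inner_single_left]
  simp

theorem fock_apply (k i : ℕ) : fock k i = if i = k then 1 else 0 := by
  rw [fock, lp.coeFn_single, Pi.single_apply]

theorem fock₂_apply (p q : ℕ × ℕ) : fock₂ p q = if q = p then 1 else 0 := by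
  rw [fock₂, lp.coeFn_single, Pi.single_apply]

theorem hasFockElements_iff {U : TwoMode →L[ℂ] TwoMode} {T : FockArray} :
    HasFockElements U T ↔ ∀ m n, U (fock₂ n) m = T m n := by
  simp only [HasFockElements, inner_fock₂]

theorem ext_fock₂ {E : Type*} [NormedAddCommGroup E] [NormedSpace ℂ E] {A B : TwoMode →L[ℂ] E}
    (h : ∀ n, A (fock₂ n) = B (fock₂ n)) : A = B := by
  ext x
  have hx := lp.hasSum_single (p := 2) (by simp) x
  have key : ∀ n, A (lp.single 2 n (x n)) = B (lp.single 2 n (x n)) := by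
    intro n
    have : lp.single 2 n (x n) = (x n) • fock₂ n := by
      rw [fock₂, ← lp.single_smul]
      simp
    rw [this, map_smul, map_smul, h]
  have h1 := hx.mapL A
  have h2 := hx.mapL B
  simp only [key] at h1
  exact h1.unique h2

theorem HasFockElements.unique {U U' : TwoMode →L[ℂ] TwoMode} {T : FockArray}
    (h : HasFockElements U T) (h' : HasFockElements U' T) : U = U' := by
  rw [hasFockElements_iff] at h h'
  refine ext_fock₂ fun n => ?_
  ext m
  rw [h, h']

theorem HasFockElements.fockOperator_eq {U : TwoMode →L[ℂ] TwoMode} {T : FockArray}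
    (h : HasFockElements U T) : fockOperator T = U := by
  have hex : ∃ U : TwoMode →L[ℂ] TwoMode, HasFockElements U T := ⟨U, h⟩
  rw [fockOperator, dif_pos hex]
  exact hex.choose_spec.unique h

theorem HasFockElements.adjoint {U : TwoMode →L[ℂ] TwoMode} {T : FockArray}
    (h : HasFockElements U T) :
    HasFockElements (ContinuousLinearMap.adjoint U) fun m n => T n m := by
  intro m n
  rw [ContinuousLinearMap.adjoint_inner_right, ← inner_conj_symm, h n m, Complex.conj_ofReal]

theorem exists_linearIsometry {T : FockArray}
    (hcol : ∀ n n', HasSum (fun m => T m n * T m n') (if n = n' then 1 else 0)) :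
    ∃ V : TwoMode →ₗᵢ[ℂ] TwoMode, HasFockElements V.toContinuousLinearMap T := by
  have hmem : ∀ n, Memℓp (fun m => (T m n : ℂ)) 2 := fun n => memℓp_gen <| by
    refine (hcol n n).summable.congr fun m => ?_
    simp [sq]
  let v : ℕ × ℕ → TwoMode := fun n => ⟨fun m => (T m n : ℂ), hmem n⟩
  have hv : Orthonormal ℂ v := by
    rw [orthonormal_iff_ite]
    intro n n'
    have h1 := lp.hasSum_inner (𝕜 := ℂ) (v n) (v n')
    have h2 := Complex.hasSum_ofReal.2 (hcol n n')
    have h3 : ∀ m, ⟪v n m, v n' m⟫_ℂ = ((T m n * T m n' : ℝ) : ℂ) := by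
      intro m
      change (T m n' : ℂ) * (starRingEnd ℂ) (T m n : ℂ) = _
      rw [Complex.conj_ofReal]
      push_cast
      ring
    simp only [h3] at h1
    rw [h1.unique h2]
    split_ifs <;> simp
  refine ⟨hv.orthogonalFamily.linearIsometry, hasFockElements_iff.2 fun m n => ?_⟩
  have := hv.orthogonalFamily.linearIsometry_apply_single (i := n) (1 : ℂ)
  change hv.orthogonalFamily.linearIsometry (fock₂ n) m = _
  rw [fock₂, this]
  simp [v]

/-- Columns and rows give isometries `V` and `W`. The matrix elements of `W` are those of the
adjoint of `V`, so `V` has an isometric adjoint and is unitary. -/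
theorem isUnitaryWithElements_fockOperator {T : FockArray}
    (hcol : ∀ n n', HasSum (fun m => T m n * T m n') (if n = n' then 1 else 0))
    (hrow : ∀ m m', HasSum (fun n => T m n * T m' n) (if m = m' then 1 else 0)) :
    IsUnitaryWithElements (fockOperator T) T := by
  obtain ⟨V, hV⟩ := exists_linearIsometry hcol
  obtain ⟨W, hW⟩ := exists_linearIsometry (T := fun m n => T n m) hrow
  have hVW : ContinuousLinearMap.adjoint V.toContinuousLinearMap = W.toContinuousLinearMap :=
    hV.adjoint.unique hW
  have hV1 := (ContinuousLinearMap.norm_map_iff_adjoint_comp_self V.toContinuousLinearMap).1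
    V.norm_map
  have hW1 := (ContinuousLinearMap.norm_map_iff_adjoint_comp_self W.toContinuousLinearMap).1
    W.norm_map
  rw [hV.fockOperator_eq]
  refine ⟨Unitary.mem_iff.2 ⟨hV1, ?_⟩, hV⟩
  rw [← hVW, ContinuousLinearMap.adjoint_adjoint] at hW1
  exact hW1

theorem isUnitaryWithElements_of_transpose {T : FockArray} (ε : ℕ × ℕ → ℝ)
    (hε : ∀ n, ε n * ε n = 1) (hT : ∀ m n, T n m = ε m * ε n * T m n)
    (hcol : ∀ n n', HasSum (fun m => T m n * T m n') (if n = n' then 1 else 0)) :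
    IsUnitaryWithElements (fockOperator T) T := by
  refine isUnitaryWithElements_fockOperator hcol fun m m' => ?_
  refine hasSum_of_eq ((hcol m m').mul_left (ε m * ε m')) (fun n => ?_) ?_
  · rw [hT n m, hT n m']
    linear_combination T n m * T n m' * ε m * ε m' * hε n
  · split_ifs with h
    · rw [h, hε, mul_one]
    · rw [mul_zero]

theorem isUnitaryWithElements_ampU {κ : ℝ} (hκ : 1 ≤ κ) :
    IsUnitaryWithElements (ampU κ) (ampElements κ) := by
  have hc : 0 < κ⁻¹ := by positivity
  have hc1 : κ⁻¹ ≤ 1 := inv_le_one_of_one_le₀ hκ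
  have h : κ⁻¹ ^ 2 + √(1 - κ⁻¹ ^ 2) ^ 2 = 1 := by
    rw [Real.sq_sqrt (by nlinarith)]
    ring
  rw [ampU, ampElements_eq]
  refine isUnitaryWithElements_of_transpose (fun n => (-1) ^ n.1) (fun n => ?_) (fun m n => ?_)
    (hasSum_squeezeArray hc h)
  · rw [← mul_pow]; simp
  · rw [squeezeArray_transpose, pow_add]

theorem isUnitaryWithElements_attU {κ : ℝ} (hκ : 0 ≤ κ) (hκ' : κ ≤ 1) :
    IsUnitaryWithElements (attU κ) (attElements κ) := by
  have h : κ ^ 2 + (-√(1 - κ ^ 2)) ^ 2 = 1 := by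
    rw [neg_sq, Real.sq_sqrt (by nlinarith)]
    ring
  rw [attU, attElements_eq]
  refine isUnitaryWithElements_of_transpose (fun n => (-1) ^ n.2) (fun n => ?_) (fun m n => ?_)
    (hasSum_splitArray h)
  · rw [← mul_pow]; simp
  · rw [splitArray_transpose, pow_add]

theorem hasSum_mul_ite_eq (f : ℕ × ℕ → ℕ × ℕ) (hf : f.Injective) (ε : ℕ × ℕ → ℝ)
    (hε : ∀ n, ε n * ε n = 1) (n n' : ℕ × ℕ) :
    HasSum (fun m => (if m = f n then ε n else 0) * (if m = f n' then ε n' else 0))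
      (if n = n' then 1 else 0) := by
  refine hasSum_of_eq (hasSum_single (f n) fun m hm => ?_) (fun _ => rfl) ?_
  · rw [if_neg hm, zero_mul]
  · by_cases h : n = n'
    · subst h
      rw [if_pos rfl, if_pos rfl, hε]
    · rw [if_neg h, if_neg fun h' => h (hf h'), mul_zero]

theorem isUnitaryWithElements_flipU :
    IsUnitaryWithElements flipU fun m n => if m.1 = n.2 ∧ m.2 = n.1 then 1 else 0 := by
  refine isUnitaryWithElements_of_transpose (fun _ => 1) (by simp) (fun m n => ?_) fun n n' => ?_
  · simp only [mul_one, one_mul]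
    exact if_congr (by omega) rfl rfl
  · refine hasSum_of_eq (hasSum_mul_ite_eq Prod.swap Prod.swap_injective (fun _ => 1) (by simp) n n')
      (fun m => ?_) rfl
    simp [Prod.ext_iff]

theorem isUnitaryWithElements_phaseU :
    IsUnitaryWithElements phaseU fun m n => if m.1 = n.1 ∧ m.2 = n.2 then (-1) ^ n.2 else 0 := by
  refine isUnitaryWithElements_of_transpose (fun _ => 1) (by simp) (fun m n => ?_) fun n n' => ?_
  · simp only [mul_one, one_mul]
    by_cases h : m.1 = n.1 ∧ m.2 = n.2
    · rw [if_pos h, if_pos (by omega), h.2]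
    · rw [if_neg h, if_neg (by omega)]
  · refine hasSum_of_eq (hasSum_mul_ite_eq id Function.injective_id (fun n => (-1) ^ n.2)
      (fun n => by rw [← mul_pow]; simp) n n') (fun m => ?_) rfl
    simp [Prod.ext_iff]

theorem adjoint_flipU : ContinuousLinearMap.adjoint flipU = flipU := by
  refine HasFockElements.unique (isUnitaryWithElements_flipU.2.adjoint) ?_
  refine fun m n => (isUnitaryWithElements_flipU.2 m n).trans ?_
  congr 1
  exact if_congr (by omega) rfl rfl

theorem flipU_fock₂ (n : ℕ × ℕ) : flipU (fock₂ n) = fock₂ n.swap := by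
  ext m
  rw [hasFockElements_iff.1 isUnitaryWithElements_flipU.2, fock₂_apply]
  simp [Prod.ext_iff, apply_ite]

theorem flipU_apply (x : TwoMode) (m : ℕ × ℕ) : flipU x m = x m.swap := by
  rw [← inner_fock₂, ← adjoint_flipU, ContinuousLinearMap.adjoint_inner_right, flipU_fock₂,
    inner_fock₂]

theorem phaseU_fock₂ (n : ℕ × ℕ) : phaseU (fock₂ n) = (-1 : ℂ) ^ n.2 • fock₂ n := by
  ext m
  rw [hasFockElements_iff.1 isUnitaryWithElements_phaseU.2, lp.coeFn_smul, Pi.smul_apply,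
    fock₂_apply]
  by_cases h : m = n
  · simp [h]
  · rw [if_neg fun h' => h (Prod.ext h'.1 h'.2), if_neg h]
    simp

/-! ### Operator identities with the flip and the parity -/

theorem HasFockElements.comp_flipU {U : TwoMode →L[ℂ] TwoMode} {T : FockArray}
    (h : HasFockElements U T) : HasFockElements (U.comp flipU) fun m n => T m n.swap := by
  intro m n
  rw [ContinuousLinearMap.comp_apply, flipU_fock₂, h]

theorem HasFockElements.flipU_comp {U : TwoMode →L[ℂ] TwoMode} {T : FockArray}
    (h : HasFockElements U T) : HasFockElements (flipU.comp U) fun m n => T m.swap n := by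
  intro m n
  rw [ContinuousLinearMap.comp_apply, ← adjoint_flipU, ContinuousLinearMap.adjoint_inner_right,
    flipU_fock₂, h]

theorem HasFockElements.comp_phaseU {U : TwoMode →L[ℂ] TwoMode} {T : FockArray}
    (h : HasFockElements U T) : HasFockElements (U.comp phaseU) fun m n => (-1) ^ n.2 * T m n := by
  intro m n
  rw [ContinuousLinearMap.comp_apply, phaseU_fock₂, map_smul, inner_smul_right, h]
  push_cast
  rfl

theorem hasFockElements_ampU_comp_flipU {κ : ℝ} (hκ : 1 ≤ κ) :
    HasFockElements ((ampU κ).comp flipU) (conjElements √(κ ^ 2 - 1)) := by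
  intro m n
  rw [conjElements_eq hκ]
  exact (isUnitaryWithElements_ampU hκ).2.comp_flipU m n

theorem conjU_eq_ampU_comp_flipU {κ : ℝ} (hκ : 1 ≤ κ) :
    conjU √(κ ^ 2 - 1) = (ampU κ).comp flipU :=
  (hasFockElements_ampU_comp_flipU hκ).fockOperator_eq

/-- The flip on the output side is the one that the complementary channel produces. -/
theorem conjU_eq_flipU_comp_ampU {κ : ℝ} (hκ : 1 ≤ κ) :
    conjU √(κ ^ 2 - 1) = flipU.comp (ampU κ) := by
  refine HasFockElements.fockOperator_eq fun m n => ?_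
  rw [conjElements_eq hκ, (isUnitaryWithElements_ampU hκ).2.flipU_comp m n, ampElements_eq,
    ← squeezeArray_swap, Prod.swap_swap]

theorem isUnitaryWithElements_conjU {κ : ℝ} (hκ : 1 ≤ κ) :
    IsUnitaryWithElements (conjU √(κ ^ 2 - 1)) (conjElements √(κ ^ 2 - 1)) := by
  rw [conjU_eq_ampU_comp_flipU hκ]
  exact ⟨mul_mem (isUnitaryWithElements_ampU hκ).1 isUnitaryWithElements_flipU.1,
    hasFockElements_ampU_comp_flipU hκ⟩

theorem attU_sqrt_eq {κ : ℝ} (hκ : 0 ≤ κ) (hκ' : κ ≤ 1) :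
    attU √(1 - κ ^ 2) = flipU.comp ((attU κ).comp phaseU) := by
  refine HasFockElements.fockOperator_eq fun m n => ?_
  rw [(isUnitaryWithElements_attU hκ hκ').2.comp_phaseU.flipU_comp m n, attElements_eq,
    attElements_eq, Real.sq_sqrt (by nlinarith), sub_sub_cancel, Real.sqrt_sq hκ]
  dsimp only
  rw [← splitArray_swap, neg_neg]

/-! ### Positive square roots and Hilbert–Schmidt sums -/

theorem IsPositive.exists_isSelfAdjoint_sq_eq {H : Type*} [NormedAddCommGroup H]
    [InnerProductSpace ℂ H] [CompleteSpace H] {ρ : H →L[ℂ] H} (hρ : ρ.IsPositive) :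
    ∃ S : H →L[ℂ] H, ContinuousLinearMap.adjoint S = S ∧ S.comp S = ρ := by
  have h : 0 ≤ ρ := (ContinuousLinearMap.nonneg_iff_isPositive ρ).2 hρ
  exact ⟨CFC.sqrt ρ, (CFC.sqrt_nonneg ρ).isSelfAdjoint, CFC.sqrt_mul_sqrt_self ρ h⟩

/-- Tonelli's theorem for nonnegative double series. -/
theorem hasSum_comm_of_nonneg {ι ι' : Type*} {F : ι' → ι → ℝ} {r : ι' → ℝ} {c : ι → ℝ} {t : ℝ}
    (hF : ∀ i' i, 0 ≤ F i' i) (hrow : ∀ i', HasSum (F i') (r i'))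
    (hcol : ∀ i, HasSum (fun i' => F i' i) (c i)) (h : HasSum r t) : HasSum c t := by
  have hsum : Summable fun q : ι' × ι => F q.1 q.2 := by
    rw [summable_prod_of_nonneg fun q => hF q.1 q.2]
    refine ⟨fun i' => (hrow i').summable, ?_⟩
    simp only [fun i' => (hrow i').tsum_eq]
    exact h.summable
  have ht := hsum.hasSum
  rw [(ht.prod_fiberwise hrow).unique h] at ht
  exact ((Equiv.prodComm ι ι').hasSum_iff.2 ht).prod_fiberwise hcol

section HilbertSchmidt

variable {ι ι' : Type*}

theorem hasSum_norm_sq (x : lp (fun _ : ι => ℂ) 2) : HasSum (fun i => ‖x i‖ ^ 2) (‖x‖ ^ 2) := by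
  simpa using lp.hasSum_norm (p := 2) (by simp) x

variable [DecidableEq ι]

theorem norm_apply_single_symm [DecidableEq ι']
    (A : lp (fun _ : ι => ℂ) 2 →L[ℂ] lp (fun _ : ι' => ℂ) 2) (i : ι)
    (i' : ι') : ‖A (lp.single 2 i 1) i'‖ =
      ‖ContinuousLinearMap.adjoint A (lp.single 2 i' 1) i‖ := by
  have h1 : A (lp.single 2 i 1) i' =
      ⟪(lp.single 2 i' 1 : lp (fun _ : ι' => ℂ) 2), A (lp.single 2 i 1)⟫_ℂ := by
    rw [lp.inner_single_left]; simp
  have h2 : ContinuousLinearMap.adjoint A (lp.single 2 i' 1) i =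
      ⟪(lp.single 2 i 1 : lp (fun _ : ι => ℂ) 2),
        ContinuousLinearMap.adjoint A (lp.single 2 i' 1)⟫_ℂ := by
    rw [lp.inner_single_left]; simp
  rw [h1, h2, ContinuousLinearMap.adjoint_inner_right, norm_inner_symm]

/-- An operator and its adjoint have the same Hilbert–Schmidt norm. -/
theorem hasSum_norm_sq_adjoint [DecidableEq ι']
    (A : lp (fun _ : ι => ℂ) 2 →L[ℂ] lp (fun _ : ι' => ℂ) 2) {t : ℝ}
    (h : HasSum (fun i' => ‖ContinuousLinearMap.adjoint A (lp.single 2 i' 1)‖ ^ 2) t) :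
    HasSum (fun i => ‖A (lp.single 2 i 1)‖ ^ 2) t := by
  have hrow : ∀ i', HasSum (fun i => ‖ContinuousLinearMap.adjoint A (lp.single 2 i' 1) i‖ ^ 2)
      (‖ContinuousLinearMap.adjoint A (lp.single 2 i' 1)‖ ^ 2) :=
    fun i' => hasSum_norm_sq (ContinuousLinearMap.adjoint A (lp.single 2 i' 1))
  have hcol : ∀ i, HasSum (fun i' => ‖ContinuousLinearMap.adjoint A (lp.single 2 i' 1) i‖ ^ 2)
      (‖A (lp.single 2 i 1)‖ ^ 2) := fun i =>
    hasSum_of_eq (hasSum_norm_sq (A (lp.single 2 i 1)))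
      (fun i' => by rw [norm_apply_single_symm A i i']) rfl
  exact hasSum_comm_of_nonneg (fun _ _ => sq_nonneg _) hrow hcol h

/-- The operator norm is at most the Hilbert–Schmidt norm: Cauchy–Schwarz bounds each coordinate of
`A† y`. -/
theorem norm_adjoint_comp_self_le (A : lp (fun _ : ι => ℂ) 2 →L[ℂ] lp (fun _ : ι' => ℂ) 2) {t : ℝ}
    (h : HasSum (fun i => ‖A (lp.single 2 i 1)‖ ^ 2) t) :
    ‖(ContinuousLinearMap.adjoint A).comp A‖ ≤ t := by
  have ht : 0 ≤ t := h.nonneg fun i => by positivity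
  have key : ‖ContinuousLinearMap.adjoint A‖ ≤ √t := by
    refine ContinuousLinearMap.opNorm_le_bound _ (Real.sqrt_nonneg _) fun y => ?_
    have h1 := hasSum_norm_sq (ContinuousLinearMap.adjoint A y)
    have h2 := h.mul_right (‖y‖ ^ 2)
    have h3 : ‖ContinuousLinearMap.adjoint A y‖ ^ 2 ≤ t * ‖y‖ ^ 2 := by
      refine hasSum_le (fun i => ?_) h1 h2
      have : ContinuousLinearMap.adjoint A y i = ⟪A (lp.single 2 i 1), y⟫_ℂ := by
        rw [← ContinuousLinearMap.adjoint_inner_right, lp.inner_single_left]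
        simp
      rw [this, ← mul_pow]
      gcongr
      exact norm_inner_le_norm _ _
    refine le_of_sq_le_sq ?_ (by positivity)
    rwa [mul_pow, Real.sq_sqrt ht]
  rw [ContinuousLinearMap.norm_adjoint_comp_self, ← LinearIsometryEquiv.norm_map
    ContinuousLinearMap.adjoint A, ← sq]
  calc _ ≤ √t ^ 2 := by gcongr
    _ = t := Real.sq_sqrt ht

end HilbertSchmidt

/-! ### Partial traces, complementary channels and states -/

theorem appendEnv_apply (ψ f : Mode) : appendEnv ψ f = tensor f ψ := rfl

theorem appendSys_apply (χ f : Mode) : appendSys χ f = tensor χ f := rfl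

theorem tensor_apply (f g : Mode) (p : ℕ × ℕ) : tensor f g p = f p.1 * g p.2 := rfl

theorem appendEnv_fock_fock (j k : ℕ) : appendEnv (fock k) (fock j) = fock₂ (j, k) := by
  ext p
  rw [appendEnv_apply, tensor_apply, fock_apply, fock_apply, fock₂_apply]
  by_cases h : p = (j, k)
  · subst h; simp
  · rw [if_neg h]
    by_cases h1 : p.1 = j
    · rw [if_neg (c := p.2 = k) fun h2 => h (Prod.ext h1 h2), mul_zero]
    · rw [if_neg h1, zero_mul]

theorem norm_fock (k : ℕ) : ‖fock k‖ = 1 := by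
  rw [fock, lp.norm_single (by simp)]
  simp

theorem flipU_comp_appendEnv (ψ : Mode) : flipU.comp (appendEnv ψ) = appendSys ψ := by
  ext f p
  rw [ContinuousLinearMap.comp_apply, flipU_apply, appendEnv_apply, appendSys_apply, tensor_apply,
    tensor_apply, mul_comm]
  rfl

theorem traceSys_eq (X : TwoMode →L[ℂ] TwoMode) :
    traceSys X = traceEnv (flipU.comp (X.comp (ContinuousLinearMap.adjoint flipU))) := by
  simp only [traceSys, traceEnv, ← flipU_comp_appendEnv, ContinuousLinearMap.adjoint_comp,
    adjoint_flipU, ContinuousLinearMap.comp_assoc]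

theorem comp_conj_adjoint (A B W : TwoMode →L[ℂ] TwoMode) :
    (A.comp B).comp (W.comp (ContinuousLinearMap.adjoint (A.comp B))) =
      A.comp ((B.comp (W.comp (ContinuousLinearMap.adjoint B))).comp
        (ContinuousLinearMap.adjoint A)) := by
  refine ContinuousLinearMap.ext fun x => ?_
  have h : ContinuousLinearMap.adjoint (A.comp B) x =
      ContinuousLinearMap.adjoint B (ContinuousLinearMap.adjoint A x) := by
    rw [ContinuousLinearMap.adjoint_comp, ContinuousLinearMap.comp_apply]
  exact congrArg (fun y => A (B (W y))) h

theorem complementaryChannel_eq (U : TwoMode →L[ℂ] TwoMode) (ψ : Mode) (ρ : Mode →L[ℂ] Mode) :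
    (Dilation.mk U ψ).complementaryChannel ρ = (Dilation.mk (flipU.comp U) ψ).channel ρ :=
  (traceSys_eq _).trans (congrArg traceEnv (comp_conj_adjoint flipU U (withEnv ρ ψ)).symm)

theorem phaseU_comp_appendEnv_fock (n : ℕ) :
    phaseU.comp (appendEnv (fock n)) = (-1 : ℂ) ^ n • appendEnv (fock n) := by
  have hadj : ContinuousLinearMap.adjoint phaseU = phaseU := by
    refine isUnitaryWithElements_phaseU.2.adjoint.unique ?_
    refine fun m n => (isUnitaryWithElements_phaseU.2 m n).trans ?_
    congr 1
    dsimp only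
    by_cases h : m.1 = n.1 ∧ m.2 = n.2
    · rw [if_pos h, if_pos (by omega), h.2]
    · rw [if_neg h, if_neg (by omega)]
  ext f p
  have h1 : phaseU (tensor f (fock n)) p = (-1 : ℂ) ^ p.2 * tensor f (fock n) p := by
    rw [← inner_fock₂ p (phaseU _), ← hadj, ContinuousLinearMap.adjoint_inner_right, phaseU_fock₂,
      inner_smul_left, inner_fock₂]
    simp
  change phaseU (tensor f (fock n)) p = (-1 : ℂ) ^ n * tensor f (fock n) p
  rw [h1, tensor_apply, fock_apply]
  by_cases h : p.2 = n
  · rw [h]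
  · simp [h]

/-- On the environment state `fock n` the parity is the scalar `(-1) ^ n`, which cancels against its
adjoint. -/
theorem channel_comp_phaseU (U : TwoMode →L[ℂ] TwoMode) (n : ℕ) (ρ : Mode →L[ℂ] Mode) :
    (Dilation.mk (U.comp phaseU) (fock n)).channel ρ = (Dilation.mk U (fock n)).channel ρ := by
  have h : phaseU.comp ((withEnv ρ (fock n)).comp (ContinuousLinearMap.adjoint phaseU)) =
      withEnv ρ (fock n) := by
    have h1 := congrArg ContinuousLinearMap.adjoint (phaseU_comp_appendEnv_fock n)
    rw [ContinuousLinearMap.adjoint_comp] at h1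
    rw [withEnv, ContinuousLinearMap.comp_assoc, ContinuousLinearMap.comp_assoc, h1,
      ← ContinuousLinearMap.comp_assoc, phaseU_comp_appendEnv_fock]
    rw [map_smulₛₗ, ContinuousLinearMap.smul_comp, ContinuousLinearMap.comp_smul,
      ContinuousLinearMap.comp_smul, smul_smul]
    simp [← mul_pow]
  refine congrArg traceEnv ((comp_conj_adjoint U phaseU (withEnv ρ (fock n))).trans ?_)
  refine congrArg U.comp (congrArg (fun W : TwoMode →L[ℂ] TwoMode =>
    W.comp (ContinuousLinearMap.adjoint U)) h)

/-- A channel with a unitary (or merely isometric) coupling and a pure environment maps states to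
states. -/
theorem isState_channel {U : TwoMode →L[ℂ] TwoMode} (hU : U ∈ unitary (TwoMode →L[ℂ] TwoMode))
    {ψ : Mode} (hψ : ‖ψ‖ = 1) {ρ : Mode →L[ℂ] Mode} (hρ : IsState ρ) :
    IsState ((Dilation.mk U ψ).channel ρ) := by
  obtain ⟨S, hS, hSS⟩ := IsPositive.exists_isSelfAdjoint_sq_eq hρ.1
  have hU' : ∀ x, ‖U x‖ = ‖x‖ := (ContinuousLinearMap.norm_map_iff_adjoint_comp_self U).2
    (Unitary.mem_iff.1 hU).1
  set V : Mode →L[ℂ] TwoMode := U.comp (appendEnv ψ) with hV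
  have hVn : ∀ x, ‖V x‖ = ‖x‖ := fun x => by
    rw [hV, ContinuousLinearMap.comp_apply, hU', appendEnv_apply, norm_tensor, hψ, mul_one]
  set A : TwoMode →L[ℂ] Mode := S.comp (ContinuousLinearMap.adjoint V) with hA
  have hAadj : ContinuousLinearMap.adjoint A = V.comp S := by
    rw [hA, ContinuousLinearMap.adjoint_comp, ContinuousLinearMap.adjoint_adjoint, hS]
  have hsq : ∀ {E : Type} [NormedAddCommGroup E] [InnerProductSpace ℂ E] (x : E),
      ⟪x, x⟫_ℂ = ((‖x‖ ^ 2 : ℝ) : ℂ) := fun x => by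
    rw [inner_self_eq_norm_sq_to_K]; push_cast; rfl
  -- The Hilbert–Schmidt norm of `A` is that of its adjoint `V S`. As `V` is isometric, its square
  -- is the trace of `S * S = ρ`.
  have hHS : HasSum (fun p : ℕ × ℕ => ‖A (fock₂ p)‖ ^ 2) 1 := by
    refine hasSum_norm_sq_adjoint A ?_
    rw [← Complex.hasSum_ofReal]
    have := hρ.2
    rw [Complex.ofReal_one]
    refine hasSum_of_eq this (fun k => ?_) rfl
    change ((‖ContinuousLinearMap.adjoint A (fock k)‖ ^ 2 : ℝ) : ℂ) = _
    rw [hAadj, ContinuousLinearMap.comp_apply, hVn, ← hSS, ContinuousLinearMap.comp_apply,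
      ← hsq,
      ← ContinuousLinearMap.adjoint_inner_right, hS]
  set L : ℕ → Mode →L[ℂ] Mode := fun k => A.comp (appendEnv (fock k)) with hL
  have hLf : ∀ j k, L k (fock j) = A (fock₂ (j, k)) := fun j k => by
    rw [hL, ContinuousLinearMap.comp_apply, appendEnv_fock_fock]
  set Y : ℕ → Mode →L[ℂ] Mode := fun k => (ContinuousLinearMap.adjoint (L k)).comp (L k) with hY
  have hch : (Dilation.mk U ψ).channel ρ = ∑' k, Y k := by
    simp only [Dilation.channel, traceEnv, Dilation.output, withEnv, hY, hL,
      ContinuousLinearMap.adjoint_comp, ContinuousLinearMap.adjoint_adjoint, hS, hA, hV, ← hSS,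
      ContinuousLinearMap.comp_assoc]
  have hswap := (Equiv.prodComm ℕ ℕ).hasSum_iff.2 hHS
  have hfib : ∀ k, Summable fun j => ‖L k (fock j)‖ ^ 2 := fun k => by
    simp only [hLf]
    exact hswap.summable.prod_factor k
  -- Norm convergence has to be proved, since otherwise `∑'` would take its default value `0`. Each
  -- `‖Y k‖` is bounded by one fibre of the convergent double sum for `A`.
  have hYs : Summable Y := by
    refine Summable.of_norm_bounded hswap.summable.prod fun k => ?_
    refine norm_adjoint_comp_self_le (L k) ?_
    have := (hfib k).hasSum
    simp only [hLf] at this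
    exact hasSum_of_eq this (fun j => congrArg (‖·‖ ^ 2) (hLf j k)) rfl
  rw [hch]
  refine ⟨?_, ?_⟩
  · rw [← ContinuousLinearMap.nonneg_iff_isPositive]
    refine tsum_nonneg fun k => ?_
    rw [ContinuousLinearMap.nonneg_iff_isPositive]
    exact ContinuousLinearMap.isPositive_adjoint_comp_self _
  · have hC := Complex.hasSum_ofReal.2 hHS
    rw [Complex.ofReal_one] at hC
    -- The trace is the same double sum, now taken first over `k` and then over `j`.
    refine hC.prod_fiberwise fun j => ?_
    have h1 := (hYs.hasSum.mapL (ContinuousLinearMap.apply ℂ Mode (fock j))).mapL (innerSL ℂ (fock j))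
    refine hasSum_of_eq h1 (fun k => ?_) rfl
    change _ = ⟪fock j, Y k (fock j)⟫_ℂ
    rw [← hLf, ← hsq, ← ContinuousLinearMap.adjoint_inner_right]
    rfl

end PhotonAdded

end

theorem mainTheorem4 :
    (∀ κ : ℝ, 1 ≤ κ →
      PhotonAdded.IsUnitaryWithElements (PhotonAdded.ampU κ) (PhotonAdded.ampElements κ) ∧
      PhotonAdded.IsUnitaryWithElements (PhotonAdded.conjU (√(κ ^ 2 - 1)))
        (PhotonAdded.conjElements (√(κ ^ 2 - 1))) ∧
      PhotonAdded.conjU (√(κ ^ 2 - 1)) = (PhotonAdded.ampU κ).comp PhotonAdded.flipU ∧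
      ∀ (n : ℕ) (ρ : PhotonAdded.Mode →L[ℂ] PhotonAdded.Mode), PhotonAdded.IsState ρ →
        PhotonAdded.IsState ((PhotonAdded.phaseConjugator (√(κ ^ 2 - 1)) n).channel ρ) ∧
        (PhotonAdded.amplifier κ n).complementaryChannel ρ =
          (PhotonAdded.phaseConjugator (√(κ ^ 2 - 1)) n).channel ρ) ∧
    (∀ κ : ℝ, 0 ≤ κ → κ ≤ 1 →
      PhotonAdded.IsUnitaryWithElements (PhotonAdded.attU κ) (PhotonAdded.attElements κ) ∧
      PhotonAdded.attU (√(1 - κ ^ 2)) =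
        PhotonAdded.flipU.comp ((PhotonAdded.attU κ).comp PhotonAdded.phaseU) ∧
      ∀ (n : ℕ) (ρ : PhotonAdded.Mode →L[ℂ] PhotonAdded.Mode), PhotonAdded.IsState ρ →
        PhotonAdded.IsState ((PhotonAdded.attenuator (√(1 - κ ^ 2)) n).channel ρ) ∧
        (PhotonAdded.attenuator κ n).complementaryChannel ρ =
          (PhotonAdded.attenuator (√(1 - κ ^ 2)) n).channel ρ) := by
  refine ⟨fun κ hκ => ⟨PhotonAdded.isUnitaryWithElements_ampU hκ,
    PhotonAdded.isUnitaryWithElements_conjU hκ, PhotonAdded.conjU_eq_ampU_comp_flipU hκ,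
    fun n ρ hρ => ⟨PhotonAdded.isState_channel (PhotonAdded.isUnitaryWithElements_conjU hκ).1
      (PhotonAdded.norm_fock n) hρ, ?_⟩⟩,
    fun κ hκ hκ' => ⟨PhotonAdded.isUnitaryWithElements_attU hκ hκ',
      PhotonAdded.attU_sqrt_eq hκ hκ', fun n ρ hρ => ⟨PhotonAdded.isState_channel
        (PhotonAdded.isUnitaryWithElements_attU (Real.sqrt_nonneg _)
          (Real.sqrt_le_one.2 (by nlinarith))).1 (PhotonAdded.norm_fock n) hρ, ?_⟩⟩⟩
  · rw [PhotonAdded.amplifier, PhotonAdded.complementaryChannel_eq, PhotonAdded.phaseConjugator,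
      PhotonAdded.conjU_eq_flipU_comp_ampU hκ]
  · rw [PhotonAdded.attenuator, PhotonAdded.complementaryChannel_eq, PhotonAdded.attenuator,
      PhotonAdded.attU_sqrt_eq hκ hκ', ← ContinuousLinearMap.comp_assoc,
      PhotonAdded.channel_comp_phaseU]
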